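/- Let $G=(V,E)$ be a finite polytree, i.e. a directed acyclic graph whose underlying undirected graph is a tree, and let $\mathbb{K}\in\{\mathbb{R},\mathbb{C}\}$. The third-order moment model $\mathcal M^{\le 3}(G)$ is the set of all pairs $(S,T)$ with $$S=(I-\Lambda)^{-T}\,\Omega^{(2)}\,(I-\Lambda)^{-1},\qquad T_{ijk}=\sum_{a,b,c\in V}\Omega^{(3)}_{abc}\,[(I-\Lambda)^{-1}]_{ai}\,[(I-\Lambda)^{-1}]_{bj}\,[(I-\Lambda)^{-1}]_{ck},$$ where $\Lambda\in\mathbb{R}^{V\times V}$ satisfies $\Lambda_{ij}=0$ whenever $i\to j\notin E$, $\Omega^{(2)}\in\mathbb{R}^{V\times V}$ is diagonal and positive definite, and $\Omega^{(3)}\in\mathbb{R}^{V\times V\times V}$ is diagonal. Let $\mathcal I^{\le 3}(G)$ be the ideal of all polynomials over $\mathbb{K}$ in the entries $s_{ij}=s_{ji}$ of a symmetric matrix and the entries $t_{ijk}$ of a symmetric tensor that vanish on $\mathcal M^{\le 3}(G)$. A $k$-trek between $i_1,\dots,i_k\in V$ is a tuple $(P_1,\dots,P_k)$ of directed paths, possibly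 of length $0$, with a common source (the top of the trek), where $P_r$ has sink $i_r$. It is simple if its top is the only vertex lying on all the $P_r$. In a polytree there is, if a $k$-trek between $i_1,\dots,i_k$ exists, exactly one simple one; its top is denoted $\operatorname{top}(i_1,\dots,i_k)$. For $i,j\in V$ between which a 2-trek exists, the trek-matrix $A_{i,j}$ is the matrix with two rows whose columns are all $\binom{s_{ik}}{s_{jk}}$ with $\operatorname{top}(i,k)=\operatorname{top}(j,k)$ and all $\binom{t_{ilm}}{t_{jlm}}$ with $\operatorname{top}(i,l,m)=\operatorname{top}(j,l,m)$ (where both tops are required to exist). Let $I_G$ be the ideal generated by the indeterminates $s_{ij}$ for which there is no 2-trek between $i,j$, the indeterminates $t_{ijk}$ for which there is no 3-trek between $i,j,k$, and the 2-minors of all trek-matrices $A_{i,j}$. Then $$\mathcal I^{\le 3}(G)=I_G .$$ In particular, $\mathcal I^{\le 3}(G)$ is generated by linear forms (the indeterminates above) and quadratic binomials (the 2-minors, each a difference of two monomials of degree 2), and these generators form a Markov basis of $\mathcal I^{\le 3}(G)$: every monomial in $\mathcal I^{\le 3}(G)$ is divisible by one of these indeterminates, and any two monomials $x^u,x^v\notin\mathcal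 I^{\le 3}(G)$ with $x^u-x^v\in\mathcal I^{\le 3}(G)$ are connected by a finite sequence of moves between monomials, each replacing $x^{c}x^{a}$ by $x^{c}x^{b}$, where $x^a-x^b$ or $x^b-x^a$ is a 2-minor of a trek-matrix. -/

import Mathlib

namespace ThirdMoment

noncomputable section

open MvPolynomial

variable {V : Type*}

/-! ### Polytrees -/

/-- A directed graph is acyclic if it has no closed directed path of positive length. -/
def IsAcyclic (G : Digraph V) : Prop :=
  ∀ v, ¬ Relation.TransGen G.Adj v v

/-- A polytree is a directed acyclic graph whose underlying undirected graph is a tree. -/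
def IsPolytree (G : Digraph V) : Prop :=
  IsAcyclic G ∧ G.toSimpleGraphInclusive.IsTree

/-! ### The third-order moment model -/

/-- `Λ ∈ ℝ^E`: the entries of `Λ` outside the edge set are zero. -/
def IsEdgeWeight (G : Digraph V) (Λ : Matrix V V ℝ) : Prop :=
  ∀ i j, ¬ G.Adj i j → Λ i j = 0

/-- A `V × V × V` tensor is diagonal if its entries off the diagonal `i = j = k` vanish. -/
def IsDiagTensor (T : V → V → V → ℝ) : Prop :=
  ∀ i j k, ¬ (i = j ∧ j = k) → T i j k = 0

/-- The Tucker product `T • A • B • C`. -/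
def tucker [Fintype V] (T : V → V → V → ℝ) (A B C : Matrix V V ℝ) : V → V → V → ℝ :=
  fun i j k => ∑ a, ∑ b, ∑ c, T a b c * A a i * B b j * C c k

/-- The third-order moment model of `G`: all pairs of a covariance matrix and a third moment
tensor that arise from the linear structural equation model `X = Λᵀ X + ε`, where `Ω₂` and `Ω₃`
are the covariance matrix and the third moment tensor of `ε`. -/
def momentModel [Fintype V] [DecidableEq V] (G : Digraph V) :
    Set (Matrix V V ℝ × (V → V → V → ℝ)) :=
  {ST | ∃ (Λ Ω₂ : Matrix V V ℝ) (Ω₃ : V → V → V → ℝ),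
    IsEdgeWeight G Λ ∧ Ω₂.PosDef ∧ Ω₂.IsDiag ∧ IsDiagTensor Ω₃ ∧
    ST.1 = ((1 - Λ)⁻¹).transpose * Ω₂ * (1 - Λ)⁻¹ ∧
    ST.2 = tucker Ω₃ (1 - Λ)⁻¹ (1 - Λ)⁻¹ (1 - Λ)⁻¹}

/-! ### The polynomial ring in the entries of a symmetric matrix and a symmetric tensor -/

/-- Indices of the indeterminates: unordered pairs for the `s_ij`, unordered triples for the
`t_ijk`. -/
abbrev MomentVar (V : Type*) : Type _ := Sym2 V ⊕ Sym V 3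

/-- The index of `s_ij`. -/
def sVar (i j : V) : MomentVar V := Sum.inl s(i, j)

/-- The index of `t_ijk`. -/
def tVar (i j k : V) : MomentVar V := Sum.inr (i ::ₛ j ::ₛ k ::ₛ Sym.nil)

/-- The points of the model in the coordinates `s_ij`, `t_ijk`, with values in `𝕜 = ℝ` or `ℂ`. -/
def modelPoints (𝕜 : Type*) [RCLike 𝕜] [Fintype V] [DecidableEq V] (G : Digraph V) :
    Set (MomentVar V → 𝕜) :=
  {p | ∃ ST ∈ momentModel G,
    (∀ i j, p (sVar i j) = ((ST.1 i j : ℝ) : 𝕜)) ∧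
    ∀ i j k, p (tVar i j k) = ((ST.2 i j k : ℝ) : 𝕜)}

/-- The third-order moment ideal of `G`: the polynomials that vanish on the model. -/
def momentIdeal (𝕜 : Type*) [RCLike 𝕜] [Fintype V] [DecidableEq V] (G : Digraph V) :
    Ideal (MvPolynomial (MomentVar V) 𝕜) :=
  vanishingIdeal 𝕜 (modelPoints 𝕜 G)

/-! ### Treks -/

/-- `l` is the list of vertices of a directed path from `v` to `w` (possibly of length zero).
In an acyclic graph the vertices of such a list are automatically distinct. -/
def IsDirectedPath (G : Digraph V) (v w : V) (l : List V) : Prop :=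
  l.IsChain G.Adj ∧ l.head? = some v ∧ l.getLast? = some w

/-- A `k`-trek between `i 0, …, i (k - 1)`: directed paths with a common source, the top,
the `r`-th of which has sink `i r`. -/
structure Trek (G : Digraph V) {k : ℕ} (i : Fin k → V) where
  top : V
  path : Fin k → List V
  isDirectedPath : ∀ r, IsDirectedPath G top (i r) (path r)

/-- A trek is simple if its top is the only vertex lying on all of its paths. -/
def Trek.IsSimple {G : Digraph V} {k : ℕ} {i : Fin k → V} (τ : Trek G i) : Prop :=
  ∀ v, (∀ r, v ∈ τ.path r) → v = τ.top

/-- There is a trek between the given vertices. -/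
def HasTrek (G : Digraph V) {k : ℕ} (i : Fin k → V) : Prop := Nonempty (Trek G i)

/-- `v = top(i 0, …, i (k - 1))`: the vertex `v` is the top of a simple trek between the given
vertices. In a polytree there is at most one simple trek between given vertices, so that `v` is
determined by them. -/
def IsTop (G : Digraph V) {k : ℕ} (i : Fin k → V) (v : V) : Prop :=
  ∃ τ : Trek G i, τ.IsSimple ∧ τ.top = v

/-- The tops of the two families exist and are equal. -/
def SameTop (G : Digraph V) {k : ℕ} (i j : Fin k → V) : Prop :=
  ∃ v, IsTop G i v ∧ IsTop G j v

/-! ### Trek-matrices and the ideal they generate -/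

/-- The columns of the trek-matrix `A_{i,j}`: the vertices `k` with `top(i,k) = top(j,k)`, and the
pairs `(l,m)` with `top(i,l,m) = top(j,l,m)`. -/
abbrev TrekColumn (G : Digraph V) (i j : V) : Type _ :=
  {k : V // SameTop G ![i, k] ![j, k]} ⊕
    {lm : V × V // SameTop G ![i, lm.1, lm.2] ![j, lm.1, lm.2]}

/-- The indeterminate in the row of the vertex `i` and the given column. -/
def trekEntry {G : Digraph V} {i j : V} (r : V) : TrekColumn G i j → MomentVar V
  | Sum.inl k => sVar r k.1
  | Sum.inr lm => tVar r lm.1.1 lm.1.2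

/-- The trek-matrix `A_{i,j}`. -/
def trekMatrix (𝕜 : Type*) [CommRing 𝕜] (G : Digraph V) (i j : V) :
    Matrix (Fin 2) (TrekColumn G i j) (MvPolynomial (MomentVar V) 𝕜) :=
  Matrix.of fun r c => X (trekEntry (![i, j] r) c)

/-- The indeterminates `s_ij` and `t_ijk` for which there is no 2-trek between `i, j`,
respectively no 3-trek between `i, j, k`. -/
def linearGenerators (𝕜 : Type*) [CommRing 𝕜] (G : Digraph V) :
    Set (MvPolynomial (MomentVar V) 𝕜) :=
  {f | ∃ i j, ¬ HasTrek G ![i, j] ∧ f = X (sVar i j)} ∪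
    {f | ∃ i j k, ¬ HasTrek G ![i, j, k] ∧ f = X (tVar i j k)}

/-- The 2-minors of all trek-matrices `A_{i,j}`, where `i` and `j` are joined by a 2-trek. -/
def trekMinors (𝕜 : Type*) [CommRing 𝕜] (G : Digraph V) :
    Set (MvPolynomial (MomentVar V) 𝕜) :=
  {f | ∃ i j, HasTrek G ![i, j] ∧ ∃ c d : TrekColumn G i j,
    f = ((trekMatrix 𝕜 G i j).submatrix id ![c, d]).det}

/-- The ideal `I_G`. -/
def trekIdeal (𝕜 : Type*) [CommRing 𝕜] (G : Digraph V) : Ideal (MvPolynomial (MomentVar V) 𝕜) :=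
  Ideal.span (linearGenerators 𝕜 G ∪ trekMinors 𝕜 G)

/-! ### Markov bases -/

/-- A difference of two monomials of degree two (possibly zero, as for a minor with two equal
columns). -/
def IsQuadraticBinomial {σ 𝕜 : Type*} [CommRing 𝕜] (f : MvPolynomial σ 𝕜) : Prop :=
  ∃ u v : σ →₀ ℕ, u.degree = 2 ∧ v.degree = 2 ∧ f = monomial u 1 - monomial v 1

/-- One move along a binomial `x^a - x^b` of `B`, from the exponent `c + a` to `c + b`. -/
def MarkovMove {σ 𝕜 : Type*} [CommRing 𝕜] (B : Set (MvPolynomial σ 𝕜)) (u v : σ →₀ ℕ) : Prop :=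
  ∃ a b c : σ →₀ ℕ, monomial a 1 - monomial b 1 ∈ B ∧ u = c + a ∧ v = c + b

/-- A set `B` of monomials and binomials is a Markov basis of the ideal `I` if it lies in `I`,
every monomial of `I` is divisible by a monomial of `B`, and each fiber of `I` (a class of
monomials outside `I` that are congruent modulo `I`) is connected by the moves along the
binomials of `B`, in both directions, through exponents with nonnegative entries. For a toric
ideal, given by an exponent matrix `A`, the fibers are the sets `{v ∈ ℕ^σ | A v = A u}`. -/
def IsMarkovBasis {σ 𝕜 : Type*} [CommRing 𝕜] (B : Set (MvPolynomial σ 𝕜))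
    (I : Ideal (MvPolynomial σ 𝕜)) : Prop :=
  (∀ f ∈ B, f ∈ I ∧ ((∃ u, f = monomial u 1) ∨ ∃ u v, f = monomial u 1 - monomial v 1)) ∧
  (∀ u : σ →₀ ℕ, monomial u (1 : 𝕜) ∈ I → ∃ a ≤ u, monomial a (1 : 𝕜) ∈ B) ∧
  ∀ u v : σ →₀ ℕ, monomial u (1 : 𝕜) ∉ I → monomial v (1 : 𝕜) ∉ I →
    monomial u (1 : 𝕜) - monomial v 1 ∈ I → Relation.EqvGen (MarkovMove B) u v

end

end ThirdMoment

/-! In the reachability order of a polytree the top of a simple trek is a greatest lower bound: the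
paths from a vertex `u` to `i₁, …, i_k` all pass through the meet `v` of `i₁, …, i_k`. So every
coordinate of the model is a monomial, namely the `k`-th moment of the variable at `v`, which
collects the noise of all `u ≤ v`, times the edge coefficients on the simple trek. These moments and
edge coefficients can be chosen freely in a product of intervals. Hence the vanishing ideal is the
kernel of a monomial map, which sends the coordinates without a trek to zero.

It remains to connect any two monomials with the same image by the minors of the trek-matrices. View
a monomial as a multiset of boxes, the box of `s_ij` or `t_ijk` being the multiset of its indices. A
minor exchanges one element between two boxes without changing their meets. The image of a monomial
determines the sizes and meets of its boxes and, at each vertex, the multiset of the branches taken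
there by its paths. Let `v` be a maximal meet of a box. By exchanges a box with meet `v` attains, in
both monomials, a normal form of its branches at `v` that only depends on the branches at `v` of the
whole monomial. Every other path through a vertex `w > v` comes from below `w`, since `v` is
maximal, so that ends beyond `w` can be exchanged freely; this makes the two boxes equal, and they
can be removed. -/

namespace ThirdMoment

section Order

variable {V : Type*} [PartialOrder V]

/-- `v` is the greatest lower bound of the elements of `M`. -/
abbrev IsMeet (M : Multiset V) (v : V) : Prop := IsGLB {x | x ∈ M} v

/-- The greatest lower bound of a multiset, with a junk value if there is none. -/
noncomputable def meet [Nonempty V] (M : Multiset V) : V := Classical.epsilon (IsMeet M)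

theorem IsMeet.meet_eq [Nonempty V] {M : Multiset V} {v : V} (h : IsMeet M v) : meet M = v :=
  (Classical.epsilon_spec (p := IsMeet M) ⟨v, h⟩).unique h

theorem IsMeet.add_of_forall_le {K C : Multiset V} {v : V} (hK : IsMeet K v) (hC : ∀ x ∈ C, v ≤ x) :
    IsMeet (K + C) v := by
  refine ⟨fun x hx => (Multiset.mem_add.1 hx).elim (fun h => hK.1 h) (hC x), fun w hw => hK.2 ?_⟩
  exact fun x hx => hw (Multiset.mem_add.2 (Or.inl hx))

open Classical in
/-- The cover of `v` below `i`, or `v` itself if there is none. -/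
noncomputable def branch (v i : V) : V :=
  if h : ∃ c, v ⋖ c ∧ c ≤ i then h.choose else v

theorem branch_self (v : V) : branch v v = v :=
  dif_neg fun ⟨_, h, hc⟩ => h.lt.not_ge hc

/-- A partial order in which two distinct covers of `v` only lead to elements all of whose common
lower bounds lie below `v`, so that the top of a simple trek is determined by its sinks. This is
what is used of a polytree, ordered by reachability. -/
class IsTrekOrder (V : Type*) [PartialOrder V] : Prop where
  le_of_branch : ∀ {v c c' i j w : V}, v ⋖ c → v ⋖ c' → c ≠ c' → c ≤ i → c' ≤ j →
    w ≤ i → w ≤ j → w ≤ v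

variable [IsTrekOrder V]

theorem covBy_unique {u c c' e : V} (h : u ⋖ c) (h' : u ⋖ c') (hc : c ≤ e) (hc' : c' ≤ e) :
    c = c' := by
  by_contra hne
  exact h.lt.not_ge (IsTrekOrder.le_of_branch h h' hne hc hc' hc hc)

theorem branch_eq_of_covBy {v c i : V} (h : v ⋖ c) (hc : c ≤ i) : branch v i = c := by
  have hex : ∃ c, v ⋖ c ∧ c ≤ i := ⟨c, h, hc⟩
  rw [branch, dif_pos hex]
  exact covBy_unique hex.choose_spec.1 h hex.choose_spec.2 hc

variable [Finite V]

theorem covBy_branch {v i : V} (h : v < i) : v ⋖ branch v i := by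
  obtain ⟨c, hvc, hci⟩ := exists_covBy_le_of_lt h
  rwa [branch_eq_of_covBy hvc hci]

theorem branch_le {v i : V} (h : v ≤ i) : branch v i ≤ i := by
  rcases h.eq_or_lt with rfl | h
  · exact (branch_self v).le
  · obtain ⟨c, hvc, hci⟩ := exists_covBy_le_of_lt h
    rwa [branch_eq_of_covBy hvc hci]

theorem branch_eq_self_iff {v i : V} (h : v ≤ i) : branch v i = v ↔ i = v := by
  refine ⟨fun hb => ?_, fun hi => hi ▸ branch_self v⟩
  by_contra hne
  exact (covBy_branch (lt_of_le_of_ne h (Ne.symm hne))).lt.ne' hb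

theorem branch_eq_of_lt_of_le {v w i : V} (h : v < w) (hi : w ≤ i) : branch v i = branch v w :=
  branch_eq_of_covBy (covBy_branch h) ((branch_le h.le).trans hi)

theorem branch_eq_iff_of_covBy {v c i : V} (h : v ⋖ c) (hi : v ≤ i) :
    branch v i = c ↔ c ≤ i :=
  ⟨fun hb => hb ▸ branch_le hi, branch_eq_of_covBy h⟩

theorem le_total_of_mem_Icc {s x y e : V} (hx : s ≤ x) (hy : s ≤ y) (hxe : x ≤ e) (hye : y ≤ e) :
    x ≤ y ∨ y ≤ x := by
  induction s using WellFoundedGT.induction with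
  | ind s ih =>
    rcases hx.eq_or_lt with rfl | hx
    · exact Or.inl hy
    rcases hy.eq_or_lt with rfl | hy
    · exact Or.inr hx.le
    have hbranch : branch s x = branch s y :=
      covBy_unique (covBy_branch hx) (covBy_branch hy) ((branch_le hx.le).trans hxe)
        ((branch_le hy.le).trans hye)
    exact ih _ (covBy_branch hx).lt (branch_le hx.le) (hbranch ▸ branch_le hy.le)

theorem isMeet_iff_forall_covBy {M : Multiset V} {v : V} (hM : M ≠ 0) (hv : ∀ x ∈ M, v ≤ x) :
    IsMeet M v ↔ ∀ c, v ⋖ c → ∃ x ∈ M, branch v x ≠ c := by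
  constructor
  · intro h c hc
    by_contra! hall
    exact hc.lt.not_ge (h.2 fun x hx => (branch_eq_iff_of_covBy hc (hv x hx)).1 (hall x hx))
  · intro h
    refine ⟨fun x hx => hv x hx, fun w hw => ?_⟩
    obtain ⟨i, hi⟩ := Multiset.exists_mem_of_ne_zero hM
    rcases (hv i hi).eq_or_lt with rfl | hvi
    · exact hw hi
    obtain ⟨j, hj, hne⟩ := h _ (covBy_branch hvi)
    rcases (hv j hj).eq_or_lt with rfl | hvj
    · exact hw hj
    exact IsTrekOrder.le_of_branch (covBy_branch hvi) (covBy_branch hvj) hne.symm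
      (branch_le hvi.le) (branch_le hvj.le) (hw hi) (hw hj)

theorem exists_isMeet {M : Multiset V} (hM : M ≠ 0) {u : V} (hu : ∀ x ∈ M, u ≤ x) :
    ∃ v, IsMeet M v := by
  obtain ⟨v, hv⟩ := (Set.toFinite {v | ∀ x ∈ M, v ≤ x}).exists_maximal ⟨u, hu⟩
  refine ⟨v, (isMeet_iff_forall_covBy hM hv.1).2 fun c hc => ?_⟩
  by_contra! hall
  exact hc.lt.not_ge (hv.2
    (fun x hx => (branch_eq_iff_of_covBy hc (hv.1 x hx)).1 (hall x hx)) hc.le)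

theorem IsMeet.congr_map_branch {M N : Multiset V} {v : V} (h : IsMeet M v) (hM : M ≠ 0)
    (hN : ∀ x ∈ N, v ≤ x) (hMN : M.map (branch v) = N.map (branch v)) : IsMeet N v := by
  have hN0 : N ≠ 0 := by
    rintro rfl
    exact hM (Multiset.map_eq_zero.1 hMN)
  refine (isMeet_iff_forall_covBy hN0 hN).2 fun c hc => ?_
  obtain ⟨x, hx, hne⟩ := (isMeet_iff_forall_covBy hM fun x hx => h.1 hx).1 h c hc
  obtain ⟨y, hy, hxy⟩ := Multiset.mem_map.1 (hMN ▸ Multiset.mem_map_of_mem (branch v) hx)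
  exact ⟨y, hy, hxy ▸ hne⟩

end Order

section Paths

variable {V : Type*} [PartialOrder V] [Fintype V]

open Classical in
/-- The covering pairs between `s` and `i`: the edges of the directed path from `s` to `i`. -/
noncomputable def pathEdges (s i : V) : Finset (V × V) :=
  {e | e.1 ⋖ e.2 ∧ s ≤ e.1 ∧ e.2 ≤ i}

theorem mem_pathEdges {s i : V} {e : V × V} :
    e ∈ pathEdges s i ↔ e.1 ⋖ e.2 ∧ s ≤ e.1 ∧ e.2 ≤ i := by
  simp [pathEdges]

theorem pathEdges_self (s : V) : pathEdges s s = ∅ := by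
  refine Finset.eq_empty_of_forall_notMem fun e he => ?_
  obtain ⟨hcov, hs, hi⟩ := mem_pathEdges.1 he
  exact hcov.lt.not_ge (hi.trans hs)

theorem pathEdges_of_covBy {s i : V} (h : s ⋖ i) : pathEdges s i = {(s, i)} := by
  ext ⟨u, c⟩
  simp only [mem_pathEdges, Finset.mem_singleton, Prod.mk.injEq]
  constructor
  · rintro ⟨huc, hu, hc⟩
    have hus : u = s := (h.eq_or_eq hu (huc.le.trans hc)).resolve_right (huc.lt.trans_le hc).ne
    subst hus
    exact ⟨rfl, (h.eq_or_eq huc.le hc).resolve_left huc.lt.ne'⟩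
  · rintro ⟨rfl, rfl⟩
    exact ⟨h, le_rfl, le_rfl⟩

theorem disjoint_pathEdges (s g i : V) : Disjoint (pathEdges s g) (pathEdges g i) := by
  refine Finset.disjoint_left.2 fun e h h' => ?_
  rw [mem_pathEdges] at h h'
  exact h.1.lt.not_ge (h.2.2.trans h'.2.1)

variable [IsTrekOrder V]

open Classical in
theorem pathEdges_eq_union {s g i : V} (hs : s ≤ g) (hi : g ≤ i) :
    pathEdges s i = pathEdges s g ∪ pathEdges g i := by
  ext ⟨u, c⟩
  simp only [mem_pathEdges, Finset.mem_union]
  constructor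
  · rintro ⟨hcov, hu, hc⟩
    rcases le_total_of_mem_Icc hu hs (hcov.le.trans hc) hi with h | h
    · rcases h.eq_or_lt with rfl | h
      · exact Or.inr ⟨hcov, le_rfl, hc⟩
      · have hcg := branch_eq_of_covBy hcov hc ▸ branch_eq_of_lt_of_le h hi ▸ branch_le h.le
        exact Or.inl ⟨hcov, hu, hcg⟩
    · exact Or.inr ⟨hcov, h, hc⟩
  · rintro (⟨hcov, hu, hc⟩ | ⟨hcov, hu, hc⟩)
    · exact ⟨hcov, hu, hc.trans hi⟩
    · exact ⟨hcov, hs.trans hu, hc⟩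

theorem sum_pathEdges_trans {A : Type*} [AddCommMonoid A] (f : V × V → A) {s g i : V}
    (hs : s ≤ g) (hi : g ≤ i) :
    ∑ e ∈ pathEdges s i, f e = ∑ e ∈ pathEdges s g, f e + ∑ e ∈ pathEdges g i, f e := by
  classical
  rw [pathEdges_eq_union hs hi, Finset.sum_union (disjoint_pathEdges s g i)]

theorem sum_pathEdges_sub {A : Type*} [AddCommGroup A] (f : V → A) {s i : V} (h : s ≤ i) :
    ∑ e ∈ pathEdges s i, (f e.2 - f e.1) = f i - f s := by
  induction s using WellFoundedGT.induction with
  | ind s ih =>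
    rcases h.eq_or_lt with rfl | h
    · simp only [pathEdges_self, Finset.sum_empty, sub_self]
    · have hcov := covBy_branch h
      rw [sum_pathEdges_trans _ hcov.le (branch_le h.le), pathEdges_of_covBy hcov,
        Finset.sum_singleton, ih _ hcov.lt (branch_le h.le)]
      abel

/-- Both pairs of paths split at the meet of `i` and `j`. -/
theorem sum_pathEdges_exchange {A : Type*} [AddCommMonoid A] (f : V × V → A) {s t i j : V}
    (hsi : s ≤ i) (hsj : s ≤ j) (hti : t ≤ i) (htj : t ≤ j) :
    ∑ e ∈ pathEdges s i, f e + ∑ e ∈ pathEdges t j, f e =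
      ∑ e ∈ pathEdges s j, f e + ∑ e ∈ pathEdges t i, f e := by
  obtain ⟨g, hg⟩ := exists_isMeet (M := {i, j}) (by simp) (u := s) (by simp [hsi, hsj])
  have hgi : g ≤ i := hg.1 (by simp)
  have hgj : g ≤ j := hg.1 (by simp)
  have hsg : s ≤ g := hg.2 (by simp [lowerBounds, hsi, hsj])
  have htg : t ≤ g := hg.2 (by simp [lowerBounds, hti, htj])
  rw [sum_pathEdges_trans f hsg hgi, sum_pathEdges_trans f htg hgj, sum_pathEdges_trans f hsg hgj,
    sum_pathEdges_trans f htg hgi]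
  abel

end Paths

section Exchanges

variable {V : Type*} [PartialOrder V]

/-- Exchange of two ends between two boxes, leaving all meets unchanged. A multiset of boxes stands
for a monomial: each box collects the indices of one indeterminate `s_ij` or `t_ijk`. -/
def Exchange (U U' : Multiset (Multiset V)) : Prop :=
  ∃ (i j : V) (C D : Multiset V) (R : Multiset (Multiset V)) (s t : V),
    U = (i ::ₘ C) ::ₘ (j ::ₘ D) ::ₘ R ∧ U' = (j ::ₘ C) ::ₘ (i ::ₘ D) ::ₘ R ∧
    IsMeet (i ::ₘ C) s ∧ IsMeet (j ::ₘ C) s ∧ IsMeet (j ::ₘ D) t ∧ IsMeet (i ::ₘ D) t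

theorem Exchange.symm {U U' : Multiset (Multiset V)} (h : Exchange U U') : Exchange U' U := by
  obtain ⟨i, j, C, D, R, s, t, hU, hU', hiC, hjC, hjD, hiD⟩ := h
  exact ⟨j, i, C, D, R, s, t, hU', hU, hjC, hiC, hiD, hjD⟩

theorem Exchange.cons {U U' : Multiset (Multiset V)} (M : Multiset V) (h : Exchange U U') :
    Exchange (M ::ₘ U) (M ::ₘ U') := by
  obtain ⟨i, j, C, D, R, s, t, hU, hU', h⟩ := h
  refine ⟨i, j, C, D, M ::ₘ R, s, t, ?_, ?_, h⟩
  · rw [hU, Multiset.cons_swap M, Multiset.cons_swap M]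
  · rw [hU', Multiset.cons_swap M, Multiset.cons_swap M]

/-- Two multisets of boxes are connected by exchanges. -/
abbrev Exchanges : Multiset (Multiset V) → Multiset (Multiset V) → Prop :=
  Relation.ReflTransGen Exchange

theorem Exchanges.symm {U U' : Multiset (Multiset V)} (h : Exchanges U U') : Exchanges U' U :=
  have : Std.Symm (Exchange (V := V)) := ⟨fun _ _ => Exchange.symm⟩
  Relation.ReflTransGen.stdSymm.symm _ _ h

theorem Exchanges.cons {U U' : Multiset (Multiset V)} (M : Multiset V) (h : Exchanges U U') :
    Exchanges (M ::ₘ U) (M ::ₘ U') :=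
  h.lift (M ::ₘ ·) fun _ _ => Exchange.cons M

/-- All boxes have at least two elements and a greatest lower bound. -/
def IsAdmissible (U : Multiset (Multiset V)) : Prop :=
  ∀ M ∈ U, 2 ≤ M.card ∧ ∃ v, IsMeet M v

theorem IsAdmissible.of_cons {M : Multiset V} {U : Multiset (Multiset V)}
    (h : IsAdmissible (M ::ₘ U)) : IsAdmissible U :=
  fun N hN => h N (Multiset.mem_cons_of_mem hN)

theorem Exchange.isAdmissible {U U' : Multiset (Multiset V)} (h : Exchange U U')
    (hU : IsAdmissible U) : IsAdmissible U' := by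
  obtain ⟨i, j, C, D, R, s, t, rfl, rfl, -, hjC, -, hiD⟩ := h
  intro M hM
  rcases Multiset.mem_cons.1 hM with rfl | hM
  · exact ⟨by simpa using (hU (i ::ₘ C) (by simp)).1, s, hjC⟩
  rcases Multiset.mem_cons.1 hM with rfl | hM
  · exact ⟨by simpa using (hU (j ::ₘ D) (by simp)).1, t, hiD⟩
  · exact hU M (by simp [hM])

theorem Exchanges.isAdmissible {U U' : Multiset (Multiset V)} (h : Exchanges U U')
    (hU : IsAdmissible U) : IsAdmissible U' := by
  induction h with
  | refl => exact hU
  | tail _ h ih => exact h.isAdmissible ih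

theorem IsAdmissible.isMeet_meet [Nonempty V] {U : Multiset (Multiset V)} (hU : IsAdmissible U)
    {M : Multiset V} (hM : M ∈ U) : IsMeet M (meet M) := by
  obtain ⟨v, hv⟩ := (hU M hM).2
  rwa [hv.meet_eq]

theorem Exchanges.map_meet_eq [Nonempty V] {U U' : Multiset (Multiset V)} (h : Exchanges U U') :
    U.map meet = U'.map meet := by
  induction h with
  | refl => rfl
  | tail _ h ih =>
    obtain ⟨i, j, C, D, R, s, t, rfl, rfl, hiC, hjC, hjD, hiD⟩ := h
    simpa only [Multiset.map_cons, hiC.meet_eq, hjC.meet_eq, hjD.meet_eq, hiD.meet_eq] using ih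

end Exchanges

section Weights

variable {V : Type*} [PartialOrder V] [Fintype V]

/-- The parameters of the simple trek rule: `Sum.inl (k, v)` is the `k`-th moment of the variable at
`v`, to which the noise at all ancestors of `v` contributes, and `Sum.inr (u, c)` the coefficient of
the edge `u → c`. -/
abbrev TrekParam (V : Type*) : Type _ := (ℕ × V) ⊕ (V × V)

/-- The exponent of the product of the edge coefficients along the path from `s` to `i`. -/
noncomputable def pathWeight (s i : V) : TrekParam V →₀ ℕ :=
  ∑ e ∈ pathEdges s i, Finsupp.single (Sum.inr e) 1

open Classical in
theorem pathWeight_inr (s i : V) (e : V × V) :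
    pathWeight s i (Sum.inr e) = if e ∈ pathEdges s i then 1 else 0 := by
  simp [pathWeight, Finsupp.finsetSum_apply, Finsupp.single_apply]

theorem pathWeight_inl (s i : V) (p : ℕ × V) : pathWeight s i (Sum.inl p) = 0 := by
  simp [pathWeight, Finsupp.finsetSum_apply]

/-- The exponent of the monomial attached to a box, in the parametrization of the model by simple
treks: the moment at its meet, times the edge coefficients along the paths from there to its
elements. -/
noncomputable def boxWeight [Nonempty V] (M : Multiset V) : TrekParam V →₀ ℕ :=
  Finsupp.single (Sum.inl (M.card, meet M)) 1 + (M.map (pathWeight (meet M))).sum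

theorem IsMeet.boxWeight_eq [Nonempty V] {M : Multiset V} {v : V} (h : IsMeet M v) :
    boxWeight M = Finsupp.single (Sum.inl (M.card, v)) 1 + (M.map (pathWeight v)).sum := by
  rw [boxWeight, h.meet_eq]

/-- The sum of the exponents of the boxes. -/
noncomputable def weight [Nonempty V] (U : Multiset (Multiset V)) : TrekParam V →₀ ℕ :=
  (U.map boxWeight).sum

section

variable [Nonempty V]

theorem weight_cons (M : Multiset V) (U : Multiset (Multiset V)) :
    weight (M ::ₘ U) = boxWeight M + weight U := by
  rw [weight, Multiset.map_cons, Multiset.sum_cons, weight]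

open Classical in
theorem boxWeight_inl (M : Multiset V) (p : ℕ × V) :
    boxWeight M (Sum.inl p) = if p = (M.card, meet M) then 1 else 0 := by
  have hpath : (M.map (pathWeight (meet M))).sum (Sum.inl p) = 0 := by
    rw [← Finsupp.applyAddHom_apply, map_multiset_sum, Multiset.map_map]
    simp [pathWeight_inl]
  rw [boxWeight, Finsupp.add_apply, hpath, Finsupp.single_apply, add_zero]
  simp only [Sum.inl.injEq, eq_comm]

theorem boxWeight_inr (M : Multiset V) (e : V × V) :
    boxWeight M (Sum.inr e) = (M.map fun i => pathWeight (meet M) i (Sum.inr e)).sum := by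
  rw [boxWeight, Finsupp.add_apply, Finsupp.single_eq_of_ne (by simp), zero_add,
    ← Finsupp.applyAddHom_apply, map_multiset_sum, Multiset.map_map]
  rfl

theorem map_card_meet_eq_of_weight_eq {U W : Multiset (Multiset V)} (h : weight U = weight W) :
    U.map (fun M => (M.card, meet M)) = W.map fun M => (M.card, meet M) := by
  classical
  have hcount : ∀ (U : Multiset (Multiset V)) (p : ℕ × V),
      (U.map fun M => (M.card, meet M)).count p = weight U (Sum.inl p) := by
    intro U p
    induction U using Multiset.induction_on with
    | empty => simp [weight]
    | cons M U ih =>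
      rw [Multiset.map_cons, Multiset.count_cons, ih, weight_cons, Finsupp.add_apply,
        boxWeight_inl, add_comm]
  exact Multiset.ext.2 fun p => by rw [hcount, hcount, h]

end

variable [IsTrekOrder V]

open Classical in
/-- The boundary of the flow along the paths encoded by an exponent. A `k`-th moment is a source
of strength `k`, and what leaves the flow at a vertex is the number of paths ending there. -/
noncomputable def pathEnds : (TrekParam V →₀ ℕ) →+ V → ℤ :=
  Finsupp.liftAddHom fun x => multiplesHom (V → ℤ) <|
    x.elim (fun p => p.1 • Pi.single p.2 1) fun e => Pi.single e.2 1 - Pi.single e.1 1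

open Classical in
theorem pathEnds_pathWeight {s i : V} (h : s ≤ i) :
    pathEnds (pathWeight s i) = Pi.single i 1 - Pi.single s 1 := by
  simp only [pathEnds, pathWeight, map_sum, Finsupp.liftAddHom_apply_single, multiplesHom_apply,
    Sum.elim_inr, one_smul]
  exact sum_pathEdges_sub (fun v => (Pi.single v 1 : V → ℤ)) h

variable [Nonempty V]

open Classical in
theorem IsMeet.pathEnds_boxWeight {M : Multiset V} {v : V} (hv : IsMeet M v) :
    pathEnds (boxWeight M) = fun w => (M.count w : ℤ) := by
  have hpaths : (M.map fun i => pathEnds (pathWeight v i)) =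
      M.map fun i => Pi.single i 1 - Pi.single v 1 :=
    Multiset.map_congr rfl fun i hi => pathEnds_pathWeight (hv.1 hi)
  have hmoment : pathEnds (Finsupp.single (Sum.inl (M.card, v)) 1) = M.card • Pi.single v 1 := by
    simp [pathEnds]
  rw [hv.boxWeight_eq, map_add, map_multiset_sum, Multiset.map_map, Function.comp_def, hpaths,
    hmoment, Multiset.sum_map_sub, Multiset.map_const', Multiset.sum_replicate, add_sub_cancel]
  clear hv hpaths hmoment
  induction M using Multiset.induction_on with
  | empty => rfl
  | cons i M ih =>
    ext w
    simp [ih, Multiset.count_cons, Pi.single_apply, add_comm]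

theorem IsAdmissible.pathEnds_weight [DecidableEq V] {U : Multiset (Multiset V)}
    (hU : IsAdmissible U) : pathEnds (weight U) = fun w => (U.sum.count w : ℤ) := by
  induction U using Multiset.induction_on with
  | empty => simp [weight, Pi.zero_def]
  | cons M U ih =>
    obtain ⟨v, hv⟩ := (hU M (Multiset.mem_cons_self M U)).2
    rw [weight_cons, map_add, ih hU.of_cons, hv.pathEnds_boxWeight, Multiset.sum_cons]
    ext w
    rw [Multiset.count_add, Nat.cast_add, Pi.add_apply]
    congr!

theorem sum_eq_of_weight_eq {U W : Multiset (Multiset V)} (hU : IsAdmissible U)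
    (hW : IsAdmissible W) (h : weight U = weight W) : U.sum = W.sum := by
  classical
  refine Multiset.ext.2 fun w => Nat.cast_injective (R := ℤ) ?_
  exact congrFun (hU.pathEnds_weight.symm.trans (h ▸ hW.pathEnds_weight)) w

theorem Exchange.weight_eq {U U' : Multiset (Multiset V)} (h : Exchange U U') :
    weight U = weight U' := by
  obtain ⟨i, j, C, D, R, s, t, rfl, rfl, hiC, hjC, hjD, hiD⟩ := h
  have hpaths : pathWeight s i + pathWeight t j = pathWeight s j + pathWeight t i :=
    sum_pathEdges_exchange _ (hiC.1 (by simp)) (hjC.1 (by simp)) (hiD.1 (by simp))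
      (hjD.1 (by simp))
  simp only [weight_cons, hiC.boxWeight_eq, hjC.boxWeight_eq, hjD.boxWeight_eq, hiD.boxWeight_eq,
    Multiset.card_cons, Multiset.map_cons, Multiset.sum_cons]
  calc _ = Finsupp.single (Sum.inl (C.card + 1, s)) 1 + Finsupp.single (Sum.inl (D.card + 1, t)) 1 +
        (pathWeight s i + pathWeight t j) + (C.map (pathWeight s)).sum +
        (D.map (pathWeight t)).sum + weight R := by abel
    _ = _ := by rw [hpaths]; abel

theorem Exchanges.weight_eq {U U' : Multiset (Multiset V)} (h : Exchanges U U') :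
    weight U = weight U' := by
  induction h with
  | refl => rfl
  | tail _ h ih => exact ih.trans h.weight_eq

end Weights

section Branches

variable {V : Type*} [PartialOrder V]

open Classical in
/-- The branches at `w` taken by the paths from `s` to the elements of `C` that pass through `w`;
a path ending at `w` contributes `w` itself. -/
noncomputable def pathBranches (w s : V) (C : Multiset V) : Multiset V :=
  (C.filter fun i => s ≤ w ∧ w ≤ i).map (branch w)

/-- The branches at `w` taken by the paths of all boxes that pass through `w`. -/
noncomputable def branches [Nonempty V] (w : V) (U : Multiset (Multiset V)) : Multiset V :=
  U.bind fun M => pathBranches w (meet M) M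

theorem mem_pathBranches {w s c : V} {C : Multiset V} :
    c ∈ pathBranches w s C ↔ s ≤ w ∧ ∃ i ∈ C, w ≤ i ∧ branch w i = c := by
  simp only [pathBranches, Multiset.mem_map, Multiset.mem_filter]
  aesop

theorem pathBranches_cons {w s i : V} (hs : s ≤ w) (hi : w ≤ i) (C : Multiset V) :
    pathBranches w s (i ::ₘ C) = branch w i ::ₘ pathBranches w s C := by
  classical
  rw [pathBranches, Multiset.filter_cons_of_pos _ ⟨hs, hi⟩, Multiset.map_cons, pathBranches]

theorem pathBranches_cons_of_not {w s i : V} (h : ¬ (s ≤ w ∧ w ≤ i)) (C : Multiset V) :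
    pathBranches w s (i ::ₘ C) = pathBranches w s C := by
  classical
  rw [pathBranches, Multiset.filter_cons_of_neg (p := fun i => s ≤ w ∧ w ≤ i) C h, pathBranches]

theorem pathBranches_self {v : V} {C : Multiset V} (h : ∀ x ∈ C, v ≤ x) :
    pathBranches v v C = C.map (branch v) := by
  classical
  rw [pathBranches, Multiset.filter_eq_self.2 fun x hx => ⟨le_rfl, h x hx⟩]

theorem branches_cons [Nonempty V] (w : V) (M : Multiset V) (U : Multiset (Multiset V)) :
    branches w (M ::ₘ U) = pathBranches w (meet M) M + branches w U :=
  Multiset.cons_bind M U _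

theorem branches_cons_of_isMeet [Nonempty V] {v : V} {M : Multiset V} (h : IsMeet M v)
    (R : Multiset (Multiset V)) : branches v (M ::ₘ R) = M.map (branch v) + branches v R := by
  rw [branches_cons, h.meet_eq, pathBranches_self fun x hx => h.1 hx]

theorem pathBranches_add (w s : V) (C D : Multiset V) :
    pathBranches w s (C + D) = pathBranches w s C + pathBranches w s D := by
  rw [pathBranches, Multiset.filter_add, Multiset.map_add, pathBranches, pathBranches]

theorem mem_branches [Nonempty V] {w c : V} {U : Multiset (Multiset V)} :
    c ∈ branches w U ↔ ∃ M ∈ U, c ∈ pathBranches w (meet M) M :=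
  Multiset.mem_bind

section

variable [Finite V] [IsTrekOrder V]

theorem eq_or_covBy_of_mem_branches [Nonempty V] {w c : V} {U : Multiset (Multiset V)}
    (h : c ∈ branches w U) : c = w ∨ w ⋖ c := by
  obtain ⟨M, -, hM⟩ := mem_branches.1 h
  obtain ⟨-, i, -, hi, rfl⟩ := mem_pathBranches.1 hM
  rcases hi.eq_or_lt with rfl | hi
  · exact Or.inl (branch_self w)
  · exact Or.inr (covBy_branch hi)

open Classical in
theorem count_pathBranches_self {w s : V} {C : Multiset V} (h : ∀ x ∈ C, s ≤ x) :
    (pathBranches w s C).count w = C.count w := by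
  rw [pathBranches, Multiset.count_map, Multiset.filter_filter, Multiset.count,
    Multiset.countP_eq_card_filter]
  congr 1
  refine Multiset.filter_congr fun i hi => ⟨?_, ?_⟩
  · rintro ⟨hb, -, hw⟩
    exact ((branch_eq_self_iff hw).1 hb.symm).symm
  · rintro rfl
    exact ⟨(branch_self w).symm, h w hi, le_rfl⟩

open Classical in
theorem IsAdmissible.count_branches_self [Nonempty V] {U : Multiset (Multiset V)}
    (hU : IsAdmissible U) (w : V) : (branches w U).count w = U.sum.count w := by
  rw [branches, Multiset.count_bind, Multiset.map_congr rfl fun M hM =>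
    count_pathBranches_self fun x hx => (hU.isMeet_meet hM).1 hx]
  exact (map_multiset_sum (Multiset.countAddMonoidHom w) U).symm

end

section

variable [Fintype V] [IsTrekOrder V]

open Classical in
theorem count_pathBranches_of_covBy {w c : V} (h : w ⋖ c) (s : V) (C : Multiset V) :
    (pathBranches w s C).count c = (C.map fun i => pathWeight s i (Sum.inr (w, c))).sum := by
  induction C using Multiset.induction_on with
  | empty => simp [pathBranches]
  | cons i C ih =>
    have hmem : (w, c) ∈ pathEdges s i ↔ (s ≤ w ∧ w ≤ i) ∧ c = branch w i := by
      refine mem_pathEdges.trans ⟨?_, ?_⟩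
      · rintro ⟨-, hs, hc⟩
        exact ⟨⟨hs, h.le.trans hc⟩, (branch_eq_of_covBy h hc).symm⟩
      · rintro ⟨⟨hs, hi⟩, rfl⟩
        exact ⟨h, hs, branch_le hi⟩
    rw [Multiset.map_cons, Multiset.sum_cons, ← ih, pathWeight_inr]
    by_cases hi : s ≤ w ∧ w ≤ i
    · simp only [pathBranches_cons hi.1 hi.2, Multiset.count_cons, hmem, hi, and_self, true_and,
        add_comm]
    · simp only [pathBranches_cons_of_not hi, hmem, hi, false_and, if_false, zero_add]

variable [Nonempty V]

open Classical in
theorem count_branches_of_covBy {w c : V} (h : w ⋖ c) (U : Multiset (Multiset V)) :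
    (branches w U).count c = weight U (Sum.inr (w, c)) := by
  induction U using Multiset.induction_on with
  | empty => simp [branches, weight]
  | cons M U ih =>
    rw [branches_cons, Multiset.count_add, ih, count_pathBranches_of_covBy h, weight_cons,
      Finsupp.add_apply, boxWeight_inr]

theorem branches_eq_of_weight_eq {U W : Multiset (Multiset V)} (hU : IsAdmissible U)
    (hW : IsAdmissible W) (h : weight U = weight W) (w : V) : branches w U = branches w W := by
  classical
  refine Multiset.ext.2 fun c => ?_
  by_cases hcov : w ⋖ c
  · rw [count_branches_of_covBy hcov, count_branches_of_covBy hcov, h]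
  by_cases hcw : c = w
  · rw [hcw, hU.count_branches_self, hW.count_branches_self, sum_eq_of_weight_eq hU hW h]
  have hzero : ∀ U, (branches w U).count c = 0 := fun U =>
    Multiset.count_eq_zero.2 fun hmem => (eq_or_covBy_of_mem_branches hmem).elim hcw hcov
  rw [hzero, hzero]

end

theorem Exchanges.branches_eq [Finite V] [IsTrekOrder V] [Nonempty V] {U U' : Multiset (Multiset V)}
    (h : Exchanges U U') (hU : IsAdmissible U) (w : V) : branches w U = branches w U' :=
  have := Fintype.ofFinite V
  branches_eq_of_weight_eq hU (h.isAdmissible hU) h.weight_eq w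

end Branches

section Rerouting

variable {V : Type*} [PartialOrder V] [Finite V] [IsTrekOrder V]

theorem IsMeet.exchange_of_lt {C : Multiset V} {s w i j : V} (h : IsMeet (i ::ₘ C) s) (hs : s < w)
    (hi : w ≤ i) (hj : w ≤ j) : IsMeet (j ::ₘ C) s := by
  refine h.congr_map_branch (Multiset.cons_ne_zero) (fun x hx => ?_) ?_
  · rcases Multiset.mem_cons.1 hx with rfl | hx
    · exact hs.le.trans hj
    · exact h.1 (Multiset.mem_cons_of_mem hx)
  · rw [Multiset.map_cons, Multiset.map_cons, branch_eq_of_lt_of_le hs hi,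
      branch_eq_of_lt_of_le hs hj]

theorem isMeet_of_branch_ne {M : Multiset V} {v x y : V} (hM : ∀ x ∈ M, v ≤ x) (hx : x ∈ M)
    (hy : y ∈ M) (hxy : branch v x ≠ branch v y) : IsMeet M v := by
  refine (isMeet_iff_forall_covBy (fun h => by simp [h] at hx) hM).2 fun c _ => ?_
  by_contra! hall
  exact hxy ((hall x hx).trans (hall y hy).symm)

theorem isMeet_or_forall_branch_eq {v t i j : V} {D : Multiset V} (h : IsMeet (j ::ₘ D) t)
    (ht : t ≤ v) (hj : v ≤ j) (hi : v ≤ i) :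
    IsMeet (i ::ₘ D) t ∨ t = v ∧ ∀ x ∈ D, branch v x = branch v i := by
  rcases ht.lt_or_eq with ht | rfl
  · exact Or.inl (h.exchange_of_lt ht hj hi)
  refine or_iff_not_imp_right.2 fun hne => ?_
  push Not at hne
  obtain ⟨x, hx, hbx⟩ := hne rfl
  refine isMeet_of_branch_ne (fun y hy => ?_) (Multiset.mem_cons_of_mem hx)
    (Multiset.mem_cons_self i D) hbx
  rcases Multiset.mem_cons.1 hy with rfl | hy
  · exact hi
  · exact h.1 (Multiset.mem_cons_of_mem hy)

open Classical in
/-- A box with meet `v`, an end on the branch `d` and all other ends on the branch of `i` has at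
most as many ends on `d` as on the other branch, since it has at least two elements. -/
theorem count_pathBranches_le {v t i d : V} {M : Multiset V} (hM : IsMeet M t)
    (hcard : 2 ≤ M.card) (hi : v ≤ i) (hd : branch v i ≠ d)
    (hno : ∀ j D, M = j ::ₘ D → v ≤ j → branch v j = d → ¬ IsMeet (i ::ₘ D) t) :
    (pathBranches v t M).count d ≤ (pathBranches v t M).count (branch v i) := by
  by_cases hmem : d ∈ pathBranches v t M
  · obtain ⟨ht, j, hj, hvj, rfl⟩ := mem_pathBranches.1 hmem
    obtain ⟨D, rfl⟩ := Multiset.exists_cons_of_mem hj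
    obtain ⟨rfl, hD⟩ :=
      (isMeet_or_forall_branch_eq hM ht hvj hi).resolve_left (hno j D rfl hvj rfl)
    have hrep : D.map (branch t) = Multiset.replicate D.card (branch t i) :=
      Multiset.eq_replicate.2 ⟨Multiset.card_map _ _, by simpa using hD⟩
    rw [pathBranches_self fun x hx => hM.1 hx, Multiset.map_cons, hrep, Multiset.count_cons_self,
      Multiset.count_cons_of_ne hd, Multiset.count_replicate_self, Multiset.count_replicate,
      if_neg hd, zero_add]
    rw [Multiset.card_cons] at hcard
    omega
  · rw [Multiset.count_eq_zero.2 hmem]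
    exact Nat.zero_le _

variable [Nonempty V]

open Classical in
theorem exists_reroutable {v i d : V} {R : Multiset (Multiset V)} (hR : IsAdmissible R)
    (hi : v ≤ i) (h : (branches v R).count (branch v i) < (branches v R).count d) :
    ∃ j D R₀, R = (j ::ₘ D) ::ₘ R₀ ∧ v ≤ j ∧ branch v j = d ∧
      IsMeet (i ::ₘ D) (meet (j ::ₘ D)) := by
  by_contra! hall
  refine h.not_ge ?_
  rw [branches, Multiset.count_bind, Multiset.count_bind]
  refine Multiset.sum_map_le_sum_map _ _ fun N hN => ?_
  obtain ⟨R₀, rfl⟩ := Multiset.exists_cons_of_mem hN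
  refine count_pathBranches_le (hR.isMeet_meet hN) (hR N hN).1 hi (fun hd => h.ne (hd ▸ rfl)) ?_
  rintro j D rfl hj hb
  exact hall j D R₀ rfl hj hb

open Classical in
/-- One greedy step: a branch `d` that is at least as frequent outside of `K` as the branch of `i`
can be moved into the box at the expense of `i`, if this keeps the meet. -/
theorem exists_exchanges_branch_mem {v i d : V} {K C N : Multiset V} {R : Multiset (Multiset V)}
    (hU : IsAdmissible ((K + i ::ₘ C) ::ₘ R)) (hm : IsMeet (K + i ::ₘ C) v)
    (hN : branches v ((K + i ::ₘ C) ::ₘ R) = K.map (branch v) + N) (hd : d ∈ N)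
    (hcount : N.count (branch v i) ≤ N.count d)
    (hnew : ∀ j, v ≤ j → branch v j = d → (∀ x ∈ C, branch v x ≠ d) → IsMeet (K + j ::ₘ C) v) :
    ∃ j C' R', Exchanges ((K + i ::ₘ C) ::ₘ R) ((j ::ₘ K + C') ::ₘ R') ∧
      IsMeet (j ::ₘ K + C') v ∧ branch v j = d ∧ C'.card = C.card := by
  rw [branches_cons_of_isMeet hm, Multiset.map_add, add_assoc, Multiset.map_cons] at hN
  obtain rfl := add_left_cancel hN
  simp only [← Multiset.add_cons, Multiset.cons_add] at hm hU ⊢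
  by_cases hmem : d ∈ (i ::ₘ C).map (branch v)
  · obtain ⟨j, hj, hb⟩ := Multiset.mem_map.1 hmem
    obtain ⟨C', hC'⟩ := Multiset.exists_cons_of_mem hj
    have hcard : C'.card = C.card := by simpa using (congrArg Multiset.card hC').symm
    exact ⟨j, C', R, hC' ▸ .refl, hC' ▸ hm, hb, hcard⟩
  rw [← Multiset.map_cons, Multiset.count_add, Multiset.count_add,
    Multiset.count_eq_zero.2 hmem, Multiset.map_cons, Multiset.count_cons_self] at hcount
  obtain ⟨j, D, R₀, rfl, hj, rfl, hiD⟩ := exists_reroutable (hU.of_cons) (v := v) (i := i) (d := d)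
    (hm.1 (by simp)) (by omega)
  have hjC : IsMeet (K + j ::ₘ C) v :=
    hnew j hj rfl fun x hx hb => hmem (hb ▸ Multiset.mem_map_of_mem _ (by simp [hx]))
  refine ⟨j, C, (i ::ₘ D) ::ₘ R₀, .single ?_, hjC, rfl, rfl⟩
  simp only [Multiset.add_cons] at hm hjC ⊢
  exact ⟨i, j, K + C, D, R₀, v, _, rfl, rfl, hm, hjC, hU.isMeet_meet (by simp), hiD⟩

end Rerouting

section NormalForm

variable {V : Type*}

open Classical in
/-- An element of maximal multiplicity, with a junk value for the empty multiset. -/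
noncomputable def mostFrequent [Nonempty V] (N : Multiset V) : V :=
  Classical.epsilon fun d => d ∈ N ∧ ∀ s, N.count s ≤ N.count d

open Classical in
theorem mostFrequent_spec [Nonempty V] {N : Multiset V} (hN : N ≠ 0) :
    mostFrequent N ∈ N ∧ ∀ s, N.count s ≤ N.count (mostFrequent N) := by
  refine Classical.epsilon_spec (p := fun d => d ∈ N ∧ ∀ s, N.count s ≤ N.count d) ?_
  obtain ⟨d, hd, hmax⟩ := N.toFinset.exists_max_image N.count (Multiset.toFinset_nonempty.2 hN)
  refine ⟨d, Multiset.mem_toFinset.1 hd, fun s => ?_⟩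
  by_cases hs : s ∈ N
  · exact hmax s (Multiset.mem_toFinset.2 hs)
  · rw [Multiset.count_eq_zero.2 hs]
    exact Nat.zero_le _

open Classical in
/-- The multiset obtained by drawing `m` times an element of maximal multiplicity from `N`. -/
noncomputable def greedyDraw [Nonempty V] : ℕ → Multiset V → Multiset V
  | 0, _ => 0
  | m + 1, N => mostFrequent N ::ₘ greedyDraw m (N.erase (mostFrequent N))

open Classical in
/-- The branches at `v` of the normal form of a box with `m + 2` elements and meet `v`, if `B`
collects the branches at `v` of all boxes: a greedy draw from `B`, except that the second element
differs from the first one unless that is `v`, so that the box keeps its meet. -/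
noncomputable def normalBranches [Nonempty V] (v : V) (m : ℕ) (B : Multiset V) : Multiset V :=
  let d₁ := mostFrequent B
  let d₂ := mostFrequent ((B.erase d₁).filter fun s => s ≠ d₁ ∨ d₁ = v)
  d₁ ::ₘ d₂ ::ₘ greedyDraw m ((B.erase d₁).erase d₂)

variable [PartialOrder V] [Finite V] [IsTrekOrder V]

theorem isMeet_pair {v i j : V} (hi : v ≤ i) (hj : v ≤ j)
    (h : branch v j ≠ branch v i ∨ branch v i = v) : IsMeet {i, j} v := by
  have hlb : ∀ x ∈ ({i, j} : Multiset V), v ≤ x := by simp [hi, hj]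
  rcases h with h | h
  · exact isMeet_of_branch_ne hlb (by simp) (by simp) h
  · exact ⟨hlb, fun w hw => ((branch_eq_self_iff hi).1 h) ▸ hw (by simp)⟩

theorem IsMeet.exists_branch_ne {v i : V} {C : Multiset V} (h : IsMeet (i ::ₘ C) v) (hC : C ≠ 0) :
    ∃ j ∈ C, branch v j ≠ branch v i ∨ branch v i = v := by
  obtain ⟨x, hx⟩ := Multiset.exists_mem_of_ne_zero hC
  rcases (h.1 (Multiset.mem_cons_self i C)).eq_or_lt with rfl | hi
  · exact ⟨x, hx, Or.inr (branch_self v)⟩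
  obtain ⟨y, hy, hne⟩ :=
    (isMeet_iff_forall_covBy (Multiset.cons_ne_zero) h.1).1 h _ (covBy_branch hi)
  rcases Multiset.mem_cons.1 hy with rfl | hy
  · exact absurd rfl hne
  · exact ⟨y, hy, Or.inl hne⟩

variable [Nonempty V]

theorem exists_exchanges_mostFrequent {v : V} {M : Multiset V} {R : Multiset (Multiset V)}
    (hU : IsAdmissible (M ::ₘ R)) (hM : IsMeet M v) :
    ∃ i C R', Exchanges (M ::ₘ R) ((i ::ₘ C) ::ₘ R') ∧ IsMeet (i ::ₘ C) v ∧
      branch v i = mostFrequent (branches v (M ::ₘ R)) ∧ C.card + 1 = M.card := by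
  classical
  have hcard := (hU M (Multiset.mem_cons_self M R)).1
  obtain ⟨k, hk⟩ := Multiset.card_pos_iff_exists_mem.1 (zero_lt_two.trans_le hcard)
  obtain ⟨C, rfl⟩ := Multiset.exists_cons_of_mem hk
  rw [Multiset.card_cons] at hcard
  obtain ⟨x, hx⟩ := Multiset.card_pos_iff_exists_mem.1 (show 0 < C.card by omega)
  have hspec : _ ∧ _ := mostFrequent_spec (N := branches v ((k ::ₘ C) ::ₘ R)) <| by
    simp [branches_cons_of_isMeet hM]
  rw [← zero_add (k ::ₘ C)] at hU hM hspec ⊢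
  obtain ⟨i, C', R', hE, hm, hb, hcard'⟩ := exists_exchanges_branch_mem hU hM
    (N := branches v ((0 + k ::ₘ C) ::ₘ R)) (by simp) hspec.1 (hspec.2 _) fun j hj hb hne => by
      rw [zero_add] at hM ⊢
      refine isMeet_of_branch_ne (fun y hy => ?_) (Multiset.mem_cons_self j C)
        (Multiset.mem_cons_of_mem hx) (hb.trans_ne (hne x hx).symm)
      rcases Multiset.mem_cons.1 hy with rfl | hy
      · exact hj
      · exact hM.1 (Multiset.mem_cons_of_mem hy)
  rw [Multiset.cons_add, zero_add C'] at hE hm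
  exact ⟨i, C', R', hE, hm, hb, by simp [hcard']⟩

open Classical in
theorem exists_exchanges_pair {v i : V} {C : Multiset V} {R : Multiset (Multiset V)}
    (hU : IsAdmissible ((i ::ₘ C) ::ₘ R)) (hm : IsMeet (i ::ₘ C) v) :
    ∃ j C' R', Exchanges ((i ::ₘ C) ::ₘ R) (({i, j} + C') ::ₘ R') ∧ IsMeet {i, j} v ∧
      IsMeet ({i, j} + C') v ∧
      branch v j = mostFrequent (((branches v ((i ::ₘ C) ::ₘ R)).erase (branch v i)).filter
        fun s => s ≠ branch v i ∨ branch v i = v) ∧ C'.card + 1 = C.card := by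
  obtain ⟨k, hk, hbk⟩ := hm.exists_branch_ne fun hC => by
    simpa [hC] using (hU (i ::ₘ C) (Multiset.mem_cons_self _ R)).1
  obtain ⟨C, rfl⟩ := Multiset.exists_cons_of_mem hk
  let p := fun s => s ≠ branch v i ∨ branch v i = v
  set N := (branches v ((i ::ₘ k ::ₘ C) ::ₘ R)).erase (branch v i) with hN
  have hkN : branch v k ∈ N := by simp [hN, branches_cons_of_isMeet hm]
  obtain ⟨hd, hmax⟩ := mostFrequent_spec (N := N.filter p) fun h0 =>
    Multiset.notMem_zero _ (h0 ▸ Multiset.mem_filter.2 ⟨hkN, hbk⟩)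
  have hd' := Multiset.mem_filter.1 hd
  have hi : v ≤ i := hm.1 (Multiset.mem_cons_self _ _)
  have hpair : ∀ j, v ≤ j → branch v j = mostFrequent _ → IsMeet {i, j} v :=
    fun j hj hb => isMeet_pair hi hj (hb ▸ hd'.2)
  have hcount := hmax (branch v k)
  rw [Multiset.count_filter_of_pos (p := p) hbk, Multiset.count_filter_of_pos hd'.2] at hcount
  have hN' : branches v ((i ::ₘ k ::ₘ C) ::ₘ R) = ({i} : Multiset V).map (branch v) + N := by
    simp [hN, branches_cons_of_isMeet hm, Multiset.cons_swap (branch v k)]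
  have hlb : ∀ x ∈ C, v ≤ x := fun x hx => hm.1 (by simp [hx])
  have hcons : ∀ j, j ::ₘ {i} = {i, j} := fun j => Multiset.pair_comm j i
  rw [← Multiset.singleton_add i] at hU hm hN' ⊢
  obtain ⟨j, C', R', hE, hm', hb, hcard⟩ := exists_exchanges_branch_mem hU hm hN' hd'.1 hcount
    fun j hj hb _ => by
      rw [Multiset.add_cons, ← Multiset.cons_add, hcons]
      exact (hpair j hj hb).add_of_forall_le hlb
  rw [hcons] at hE hm'
  exact ⟨j, C', R', hE, hpair j (hm'.1 (by simp)) hb, hm', hb, by simp [hcard]⟩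

open Classical in
theorem exists_exchanges_greedyDraw {v : V} {K C N : Multiset V} {R : Multiset (Multiset V)}
    (hU : IsAdmissible ((K + C) ::ₘ R)) (hK : IsMeet K v) (hm : IsMeet (K + C) v)
    (hN : branches v ((K + C) ::ₘ R) = K.map (branch v) + N) :
    ∃ M R', Exchanges ((K + C) ::ₘ R) (M ::ₘ R') ∧ IsMeet M v ∧
      M.map (branch v) = K.map (branch v) + greedyDraw C.card N := by
  induction hC : C.card generalizing K C N R with
  | zero =>
    obtain rfl := Multiset.card_eq_zero.1 hC
    exact ⟨K + 0, R, .refl, hm, by simp [greedyDraw]⟩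
  | succ m ih =>
    obtain ⟨i, hi⟩ := Multiset.card_pos_iff_exists_mem.1 (m.succ_pos.trans_eq hC.symm)
    obtain ⟨C, rfl⟩ := Multiset.exists_cons_of_mem hi
    have hN0 : N ≠ 0 := by
      rintro rfl
      rw [branches_cons_of_isMeet hm, Multiset.map_add, add_assoc] at hN
      simpa using add_left_cancel hN
    have hspec := mostFrequent_spec hN0
    obtain ⟨j, C', R', hE, hm', hb, hcard⟩ := exists_exchanges_branch_mem hU hm hN hspec.1
      (hspec.2 _) fun j hj _ _ => hK.add_of_forall_le fun x hx => by
        rcases Multiset.mem_cons.1 hx with rfl | hx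
        · exact hj
        · exact hm.1 (by simp [hx])
    have hN' : branches v ((j ::ₘ K + C') ::ₘ R') =
        (j ::ₘ K).map (branch v) + N.erase (mostFrequent N) := by
      rw [← hE.branches_eq hU, hN, Multiset.map_cons, hb,
        Multiset.cons_add, ← Multiset.add_cons, Multiset.cons_erase hspec.1]
    have hjK : IsMeet (j ::ₘ K) v := by
      rw [← Multiset.singleton_add, add_comm]
      exact hK.add_of_forall_le fun x hx => hm'.1 (by simp [Multiset.mem_singleton.1 hx])
    obtain ⟨M, R'', hE', hM, hbr⟩ := ih (hE.isAdmissible hU) hjK hm' hN' (by simpa [hcard] using hC)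
    refine ⟨M, R'', hE.trans hE', hM, ?_⟩
    rw [hbr, Multiset.map_cons, hb, greedyDraw, Multiset.cons_add, Multiset.add_cons]

theorem exists_exchanges_normalBranches {v : V} {m : ℕ} {M : Multiset V}
    {R : Multiset (Multiset V)} (hU : IsAdmissible (M ::ₘ R)) (hM : IsMeet M v)
    (hcard : M.card = m + 2) :
    ∃ M' R', Exchanges (M ::ₘ R) (M' ::ₘ R') ∧ IsMeet M' v ∧
      M'.map (branch v) = normalBranches v m (branches v (M ::ₘ R)) := by
  classical
  obtain ⟨i, C, R₁, hE₁, hm₁, hi, hC⟩ := exists_exchanges_mostFrequent hU hM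
  have hU₁ := hE₁.isAdmissible hU
  obtain ⟨j, C', R₂, hE₂, hij, hm₂, hj, hC'⟩ := exists_exchanges_pair hU₁ hm₁
  rw [← hE₁.branches_eq hU] at hj
  have hN : branches v (({i, j} + C') ::ₘ R₂) = ({i, j} : Multiset V).map (branch v) +
      ((branches v (M ::ₘ R)).erase (branch v i)).erase (branch v j) := by
    rw [hE₁.branches_eq hU, hE₂.branches_eq hU₁, branches_cons_of_isMeet hm₂]
    simp
  obtain ⟨M', R₃, hE₃, hM', hbr⟩ := exists_exchanges_greedyDraw (hE₂.isAdmissible hU₁) hij hm₂ hN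
  obtain rfl : C'.card = m := by omega
  refine ⟨M', R₃, (hE₁.trans hE₂).trans hE₃, hM', ?_⟩
  rw [hbr, normalBranches, ← hi, ← hj, Multiset.insert_eq_cons, Multiset.map_cons,
    Multiset.map_singleton, Multiset.cons_add, Multiset.singleton_add]

end NormalForm

section Connectivity

variable {V : Type*} [PartialOrder V] [IsTrekOrder V] [Nonempty V]

theorem exists_exchanges_branch_eq [Finite V] {v w c i : V} {K C N : Multiset V}
    {R : Multiset (Multiset V)}
    (hU : IsAdmissible ((K + i ::ₘ C) ::ₘ R)) (hm : IsMeet (K + i ::ₘ C) v)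
    (htop : ∀ t ∈ ((K + i ::ₘ C) ::ₘ R).map meet, ¬ v < t) (hvw : v < w) (hi : w ≤ i)
    (hN : branches w ((K + i ::ₘ C) ::ₘ R) = pathBranches w v K + N) (hc : c ∈ N) :
    ∃ j C' R', Exchanges ((K + i ::ₘ C) ::ₘ R) ((K + j ::ₘ C') ::ₘ R') ∧
      IsMeet (K + j ::ₘ C') v ∧ w ≤ j ∧ branch w j = c ∧
      (j ::ₘ C').map (branch v) = (i ::ₘ C).map (branch v) := by
  rw [branches_cons, hm.meet_eq, pathBranches_add, add_assoc] at hN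
  obtain rfl := add_left_cancel hN
  rcases Multiset.mem_add.1 hc with hc | hc
  · obtain ⟨-, j, hj, hwj, hb⟩ := mem_pathBranches.1 hc
    obtain ⟨C', hC'⟩ := Multiset.exists_cons_of_mem hj
    exact ⟨j, C', R, hC' ▸ .refl, hC' ▸ hm, hwj, hb, by rw [hC']⟩
  obtain ⟨M, hM, hcM⟩ := mem_branches.1 hc
  obtain ⟨hMw, j, hj, hwj, rfl⟩ := mem_pathBranches.1 hcM
  obtain ⟨D, rfl⟩ := Multiset.exists_cons_of_mem hj
  obtain ⟨R₀, rfl⟩ := Multiset.exists_cons_of_mem hM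
  have hlt : meet (j ::ₘ D) < w :=
    hMw.lt_of_ne fun h => htop _ (Multiset.mem_map_of_mem _ (by simp)) (hvw.trans_eq h.symm)
  have hmD : IsMeet (j ::ₘ D) (meet (j ::ₘ D)) := hU.isMeet_meet (by simp)
  simp only [Multiset.add_cons] at hm ⊢
  have hnew := hm.exchange_of_lt hvw hi hwj
  refine ⟨j, C, (i ::ₘ D) ::ₘ R₀, .single ?_, hnew, hwj, rfl, ?_⟩
  · exact ⟨i, j, K + C, D, R₀, v, _, rfl, rfl, hm, hnew, hmD, hmD.exchange_of_lt hlt hwj hi⟩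
  · rw [Multiset.map_cons, Multiset.map_cons, branch_eq_of_lt_of_le hvw hi,
      branch_eq_of_lt_of_le hvw hwj]

variable [Fintype V]

theorem exists_exchanges_end_eq {v w i i' : V} {K C C' : Multiset V}
    {R R' : Multiset (Multiset V)} (hU : IsAdmissible ((K + i ::ₘ C) ::ₘ R))
    (hm : IsMeet (K + i ::ₘ C) v) (htop : ∀ t ∈ ((K + i ::ₘ C) ::ₘ R).map meet, ¬ v < t)
    (hW : IsAdmissible ((K + i' ::ₘ C') ::ₘ R')) (hm' : IsMeet (K + i' ::ₘ C') v)
    (hwt : weight ((K + i ::ₘ C) ::ₘ R) = weight ((K + i' ::ₘ C') ::ₘ R'))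
    (hvw : v < w) (hi : w ≤ i) (hi' : w ≤ i') :
    ∃ C₁ R₁, Exchanges ((K + i ::ₘ C) ::ₘ R) ((K + i' ::ₘ C₁) ::ₘ R₁) ∧
      IsMeet (K + i' ::ₘ C₁) v ∧ (i' ::ₘ C₁).map (branch v) = (i ::ₘ C).map (branch v) := by
  induction w using WellFoundedGT.induction generalizing i C R with
  | ind w ih =>
    have hN : branches w ((K + i ::ₘ C) ::ₘ R) =
        pathBranches w v K + branch w i' ::ₘ (pathBranches w v C' + branches w R') := by
      rw [branches_eq_of_weight_eq hU hW hwt, branches_cons, hm'.meet_eq, pathBranches_add,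
        pathBranches_cons hvw.le hi', add_assoc, Multiset.cons_add]
    obtain ⟨j, C₁, R₁, hE, hm₁, hj, hb, hmap⟩ :=
      exists_exchanges_branch_eq hU hm htop hvw hi hN (Multiset.mem_cons_self _ _)
    rcases hi'.eq_or_lt with rfl | hlt
    · obtain rfl := (branch_eq_self_iff hj).1 (hb.trans (branch_self w))
      exact ⟨C₁, R₁, hE, hm₁, hmap⟩
    · have hcov := (covBy_branch hlt).lt
      obtain ⟨C₂, R₂, hE₂, hm₂, hmap₂⟩ := ih _ hcov (hE.isAdmissible hU) hm₁
        (hE.map_meet_eq ▸ htop) (hE.weight_eq.symm.trans hwt) (hvw.trans hcov)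
        (hb ▸ branch_le hj) (branch_le hi')
      exact ⟨C₂, R₂, hE.trans hE₂, hm₂, hmap₂.trans hmap⟩

theorem exists_exchanges_box_eq {v : V} {K C C' : Multiset V} {R R' : Multiset (Multiset V)}
    (hU : IsAdmissible ((K + C) ::ₘ R)) (hm : IsMeet (K + C) v)
    (htop : ∀ t ∈ ((K + C) ::ₘ R).map meet, ¬ v < t)
    (hW : IsAdmissible ((K + C') ::ₘ R')) (hm' : IsMeet (K + C') v)
    (hwt : weight ((K + C) ::ₘ R) = weight ((K + C') ::ₘ R'))
    (hmap : C.map (branch v) = C'.map (branch v)) :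
    ∃ R₁, Exchanges ((K + C) ::ₘ R) ((K + C') ::ₘ R₁) := by
  classical
  induction C' using Multiset.induction_on generalizing C K R with
  | empty =>
    obtain rfl := Multiset.map_eq_zero.1 hmap
    exact ⟨R, .refl⟩
  | cons i' C' ih =>
    rw [Multiset.map_cons] at hmap
    obtain ⟨i, hi, hb, -⟩ := (Multiset.map_eq_cons _ _ _ _).2 hmap
    obtain ⟨C, rfl⟩ := Multiset.exists_cons_of_mem hi
    have hvi : v ≤ i := hm.1 (by simp)
    have hvi' : v ≤ i' := hm'.1 (by simp)
    obtain ⟨C₁, R₁, hE, hm₁, hmap₁⟩ : ∃ C₁ R₁,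
        Exchanges ((K + i ::ₘ C) ::ₘ R) ((K + i' ::ₘ C₁) ::ₘ R₁) ∧
        IsMeet (K + i' ::ₘ C₁) v ∧ (i' ::ₘ C₁).map (branch v) = (i ::ₘ C).map (branch v) := by
      rcases hvi'.eq_or_lt with rfl | hlt
      · obtain rfl := (branch_eq_self_iff hvi).1 (hb.trans (branch_self v))
        exact ⟨C, R, .refl, hm, rfl⟩
      · exact exists_exchanges_end_eq hU hm htop hW hm' hwt (covBy_branch hlt).lt
          (hb ▸ branch_le hvi) (branch_le hvi')
    have hmap₂ : C₁.map (branch v) = C'.map (branch v) := by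
      rw [Multiset.map_cons] at hmap₁
      exact (Multiset.cons_inj_right _).1 (hmap₁.trans hmap)
    have hU₁ := hE.isAdmissible hU
    have hwt₁ := hE.weight_eq.symm.trans hwt
    have htop₁ := hE.map_meet_eq ▸ htop
    simp only [Multiset.add_cons, ← Multiset.cons_add] at hE hm₁ hU₁ hwt₁ htop₁ hW hm' ⊢
    obtain ⟨R₂, hE₂⟩ := ih hU₁ hm₁ htop₁ hW hm' hwt₁ hmap₂
    exact ⟨R₂, hE.trans hE₂⟩

theorem exists_exchanges_cons_of_weight_eq {v : V} {M N : Multiset V} {U W : Multiset (Multiset V)}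
    (hU : IsAdmissible (M ::ₘ U)) (hW : IsAdmissible (N ::ₘ W))
    (hwt : weight (M ::ₘ U) = weight (N ::ₘ W)) (hM : IsMeet M v) (hN : IsMeet N v)
    (hcard : M.card = N.card) (htop : ∀ t ∈ (M ::ₘ U).map meet, ¬ v < t) :
    ∃ B U' W', Exchanges (M ::ₘ U) (B ::ₘ U') ∧ Exchanges (N ::ₘ W) (B ::ₘ W') := by
  obtain ⟨m, hm⟩ := Nat.exists_eq_add_of_le' (hU M (Multiset.mem_cons_self M U)).1
  obtain ⟨M₁, U₁, hE, hM₁, hb⟩ := exists_exchanges_normalBranches hU hM hm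
  obtain ⟨N₁, W₁, hE', hN₁, hb'⟩ := exists_exchanges_normalBranches hW hN (hcard.symm.trans hm)
  have hmap : M₁.map (branch v) = N₁.map (branch v) := by
    rw [hb, hb', branches_eq_of_weight_eq hU hW hwt]
  have hU₁ := hE.isAdmissible hU
  have hW₁ := hE'.isAdmissible hW
  have htop₁ := hE.map_meet_eq ▸ htop
  have hwt₁ := (hE.weight_eq.symm.trans hwt).trans hE'.weight_eq
  rw [← zero_add M₁] at hE hU₁ hM₁ htop₁ hwt₁
  rw [← zero_add N₁] at hE' hW₁ hN₁ hwt₁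
  obtain ⟨U₂, hE₂⟩ := exists_exchanges_box_eq hU₁ hM₁ htop₁ hW₁ hN₁ hwt₁ hmap
  exact ⟨_, U₂, W₁, hE.trans hE₂, hE'⟩

theorem exchanges_of_weight_eq {U W : Multiset (Multiset V)} (hU : IsAdmissible U)
    (hW : IsAdmissible W) (h : weight U = weight W) : Exchanges U W := by
  have hmeets := map_card_meet_eq_of_weight_eq h
  induction hn : U.card generalizing U W with
  | zero =>
    obtain rfl := Multiset.card_eq_zero.1 hn
    rw [Multiset.map_eq_zero.1 (hmeets.symm.trans (Multiset.map_zero _))]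
  | succ n ih =>
    obtain ⟨M₀, hM₀⟩ := Multiset.card_pos_iff_exists_mem.1 (n.succ_pos.trans_eq hn.symm)
    obtain ⟨v, hv, hmax⟩ := (Set.toFinite {t | t ∈ U.map meet}).exists_maximal
      ⟨_, Multiset.mem_map_of_mem _ hM₀⟩
    obtain ⟨M, hM, rfl⟩ := Multiset.mem_map.1 hv
    obtain ⟨N, hN, hNM⟩ := Multiset.mem_map.1 (hmeets ▸ Multiset.mem_map_of_mem _ hM)
    obtain ⟨hcard, hmeet⟩ := Prod.mk.inj hNM
    have hMm := hU.isMeet_meet hM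
    have hNm := hmeet ▸ hW.isMeet_meet hN
    obtain ⟨U, rfl⟩ := Multiset.exists_cons_of_mem hM
    obtain ⟨W, rfl⟩ := Multiset.exists_cons_of_mem hN
    obtain ⟨B, U', W', hE, hE'⟩ := exists_exchanges_cons_of_weight_eq hU hW h hMm hNm hcard.symm
      fun t ht hlt => hlt.not_ge (hmax ht hlt.le)
    have hrest : weight U' = weight W' := by
      have hwt := (hE.weight_eq.symm.trans h).trans hE'.weight_eq
      rw [weight_cons, weight_cons] at hwt
      exact add_left_cancel hwt
    have hn' : U'.card = n := by
      have hEcard := congrArg Multiset.card hE.map_meet_eq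
      simp only [Multiset.card_map, Multiset.card_cons] at hEcard hn
      omega
    have hE₀ := ih (hE.isAdmissible hU).of_cons (hE'.isAdmissible hW).of_cons hrest
      (map_card_meet_eq_of_weight_eq hrest) hn'
    exact (hE.trans (hE₀.cons B)).trans hE'.symm

end Connectivity

section Treks

variable {V : Type*}

theorem IsDirectedPath.eq_or_exists {G : Digraph V} {v w : V} {l : List V}
    (h : IsDirectedPath G v w l) :
    (l = [v] ∧ v = w) ∨ ∃ y t, l = v :: y :: t ∧ G.Adj v y ∧ IsDirectedPath G y w (y :: t) := by
  obtain ⟨hchain, hhead, hlast⟩ := h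
  obtain ⟨t, rfl⟩ := List.head?_eq_some_iff.1 hhead
  rcases t with _ | ⟨y, t⟩
  · exact Or.inl ⟨rfl, by simpa using hlast⟩
  · obtain ⟨hadj, hchain⟩ := List.isChain_cons_cons.1 hchain
    exact Or.inr ⟨y, t, rfl, hadj, hchain, rfl, by simpa using hlast⟩

variable [PartialOrder V]

/-- The directed graph whose edges are the covering relations of a partial order. A polytree is
the cover digraph of its reachability order. -/
def coverDigraph (V : Type*) [PartialOrder V] : Digraph V := ⟨(· ⋖ ·)⟩

theorem IsDirectedPath.mem_Icc {v w x : V} {l : List V}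
    (h : IsDirectedPath (coverDigraph V) v w l) (hx : x ∈ l) : x ∈ Set.Icc v w := by
  obtain ⟨hchain, hhead, hlast⟩ := h
  have hle : l.Pairwise (· ≤ ·) := (hchain.imp fun _ _ => CovBy.le).pairwise
  constructor
  · obtain ⟨t, rfl⟩ := List.head?_eq_some_iff.1 hhead
    exact (List.mem_cons.1 hx).elim Eq.ge (List.rel_of_pairwise_cons hle)
  · obtain ⟨t, rfl⟩ := List.getLast?_eq_some_iff.1 hlast
    exact (List.mem_append.1 hx).elim
      (fun hx => (List.pairwise_append.1 hle).2.2 x hx w (List.mem_singleton_self w))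
      fun hx => (List.mem_singleton.1 hx).le

theorem IsDirectedPath.le {v w : V} {l : List V}
    (h : IsDirectedPath (coverDigraph V) v w l) : v ≤ w :=
  (h.mem_Icc (List.mem_of_mem_head? h.2.1)).2

variable [Finite V]

theorem exists_isDirectedPath {v w : V} (h : v ≤ w) :
    ∃ l, IsDirectedPath (coverDigraph V) v w l := by
  induction v using WellFoundedGT.induction with
  | ind v ih =>
    rcases h.eq_or_lt with rfl | h
    · exact ⟨[v], .singleton v, rfl, rfl⟩
    · obtain ⟨c, hvc, hcw⟩ := exists_covBy_le_of_lt h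
      obtain ⟨l, hchain, hhead, hlast⟩ := ih c hvc.lt hcw
      obtain ⟨t, rfl⟩ := List.head?_eq_some_iff.1 hhead
      exact ⟨v :: c :: t, hchain.cons_cons hvc, rfl, by simpa using hlast⟩

theorem hasTrek_coverDigraph_iff {k : ℕ} {i : Fin k → V} :
    HasTrek (coverDigraph V) i ↔ ∃ v, ∀ r, v ≤ i r := by
  constructor
  · rintro ⟨τ⟩
    exact ⟨τ.top, fun r => (τ.isDirectedPath r).le⟩
  · rintro ⟨v, hv⟩
    choose l hl using fun r => exists_isDirectedPath (hv r)
    exact ⟨⟨v, l, hl⟩⟩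

variable [IsTrekOrder V] {k : ℕ} [NeZero k] {i : Fin k → V} {v : V}

theorem Trek.IsSimple.isMeet {τ : Trek (coverDigraph V) i} (hτ : τ.IsSimple) :
    IsMeet (Finset.univ.val.map i) τ.top := by
  refine (isMeet_iff_forall_covBy ?_ ?_).2 fun c hc => ?_
  · exact fun h => (NeZero.ne k) (by simpa using congrArg Multiset.card h)
  · simpa using fun r => (τ.isDirectedPath r).le
  by_contra! hall
  refine hc.ne' (hτ c fun r => ?_)
  have hbranch : branch τ.top (i r) = c := hall _ (Multiset.mem_map_of_mem i (Finset.mem_univ r))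
  rcases (τ.isDirectedPath r).eq_or_exists with ⟨-, h⟩ | ⟨y, t, hpath, hadj, hp⟩
  · exact absurd (by rw [← hbranch, ← h, branch_self]) hc.ne
  · obtain rfl : y = c := (branch_eq_of_covBy hadj hp.le).symm.trans hbranch
    rw [hpath]
    simp

theorem isTop_coverDigraph_iff :
    IsTop (coverDigraph V) i v ↔ IsMeet (Finset.univ.val.map i) v := by
  constructor
  · rintro ⟨τ, hτ, rfl⟩
    exact hτ.isMeet
  · intro h
    choose l hl using fun r =>
      exists_isDirectedPath (h.1 (show i r ∈ Finset.univ.val.map i by simp))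
    refine ⟨⟨v, l, hl⟩, fun x hx => ?_, rfl⟩
    refine le_antisymm (h.2 ?_) ((hl 0).mem_Icc (hx 0)).1
    rintro _ hy
    obtain ⟨r, -, rfl⟩ := Multiset.mem_map.1 (Set.mem_ofPred.1 hy)
    exact ((hl r).mem_Icc (hx r)).2

theorem hasTrek_iff_exists_isMeet :
    HasTrek (coverDigraph V) i ↔ ∃ v, IsMeet (Finset.univ.val.map i) v := by
  rw [hasTrek_coverDigraph_iff]
  constructor
  · rintro ⟨v, hv⟩
    exact exists_isMeet (fun h => (NeZero.ne k) (by simpa using congrArg Multiset.card h))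
      (u := v) (by simpa using hv)
  · rintro ⟨v, hv⟩
    exact ⟨v, fun r => hv.1 (show i r ∈ Finset.univ.val.map i by simp)⟩

theorem isMeet_pair_iff_isTop {i j v : V} :
    IsMeet (i ::ₘ {j}) v ↔ IsTop (coverDigraph V) ![i, j] v :=
  (isTop_coverDigraph_iff (i := ![i, j])).symm

theorem isMeet_triple_iff_isTop {i j k v : V} :
    IsMeet (i ::ₘ {j, k}) v ↔ IsTop (coverDigraph V) ![i, j, k] v :=
  (isTop_coverDigraph_iff (i := ![i, j, k])).symm

end Treks

open MvPolynomial

section MarkovMoves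

variable {σ τ 𝕜 : Type*} [CommRing 𝕜] {B : Set (MvPolynomial σ 𝕜)} {u v : σ →₀ ℕ}

theorem MarkovMove.mono {B' : Set (MvPolynomial σ 𝕜)} (hB : B ⊆ B') (h : MarkovMove B u v) :
    MarkovMove B' u v := by
  obtain ⟨a, b, c, hab, h⟩ := h
  exact ⟨a, b, c, hB hab, h⟩

theorem MarkovMove.monomial_sub_mem_span (h : MarkovMove B u v) :
    monomial u (1 : 𝕜) - monomial v 1 ∈ Ideal.span B := by
  obtain ⟨a, b, c, hab, rfl, rfl⟩ := h
  have hmul : monomial (c + a) (1 : 𝕜) - monomial (c + b) 1 =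
      monomial c 1 * (monomial a 1 - monomial b 1) := by
    rw [mul_sub, monomial_mul, monomial_mul, one_mul]
  exact hmul ▸ Ideal.mul_mem_left _ _ (Ideal.subset_span hab)

theorem monomial_sub_mem_span_of_eqvGen (h : Relation.EqvGen (MarkovMove B) u v) :
    monomial u (1 : 𝕜) - monomial v 1 ∈ Ideal.span B := by
  induction h with
  | rel u v h => exact h.monomial_sub_mem_span
  | refl u => simp
  | symm u v _ ih => rw [← neg_sub]; exact neg_mem ih
  | trans u v w _ _ huv hvw => rw [← sub_add_sub_cancel]; exact add_mem huv hvw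

theorem monomial_mem_span_of_X_mem {x : σ} (hX : X x ∈ B) (hx : x ∈ u.support) :
    monomial u (1 : 𝕜) ∈ Ideal.span B := by
  have hdvd : (X x : MvPolynomial σ 𝕜) ∣ monomial u 1 :=
    X_dvd_monomial.2 (Or.inr (Finsupp.mem_support_iff.1 hx))
  exact Ideal.mem_of_dvd _ hdvd (Ideal.subset_span hX)

open Classical in
/-- The monomial map that sends the indeterminates satisfying `P` to the monomials with exponents
`a` and the other indeterminates to zero. Its kernel is a toric ideal in the former, together with
the latter. -/
noncomputable def partialMonomialMap (𝕜 : Type*) [CommRing 𝕜] (P : σ → Prop) (a : σ → τ →₀ ℕ) :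
    MvPolynomial σ 𝕜 →ₐ[𝕜] MvPolynomial τ 𝕜 :=
  aeval fun x => if P x then monomial (a x) 1 else 0

variable {P : σ → Prop} {a : σ → τ →₀ ℕ}

theorem partialMonomialMap_monomial (hu : ∀ x ∈ u.support, P x) :
    partialMonomialMap 𝕜 P a (monomial u 1) = monomial (Finsupp.linearCombination ℕ a u) 1 := by
  rw [partialMonomialMap, aeval_monomial, map_one, one_mul, Finsupp.linearCombination_apply,
    Finsupp.sum, monomial_sum_one]
  refine Finset.prod_congr rfl fun x hx => ?_
  simp only [if_pos (hu x hx), monomial_pow, one_pow]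

theorem partialMonomialMap_monomial_eq_zero {x : σ} (hx : x ∈ u.support) (hP : ¬ P x) :
    partialMonomialMap 𝕜 P a (monomial u 1) = 0 := by
  rw [partialMonomialMap, aeval_monomial]
  refine mul_eq_zero_of_right _ (Finset.prod_eq_zero hx ?_)
  simp only [if_neg hP, zero_pow (Finsupp.mem_support_iff.1 hx)]

variable (hX : ∀ x, ¬ P x → X x ∈ B)
  (hconn : ∀ u v : σ →₀ ℕ, (∀ x ∈ u.support, P x) → (∀ x ∈ v.support, P x) →
    Finsupp.linearCombination ℕ a u = Finsupp.linearCombination ℕ a v →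
    Relation.EqvGen (MarkovMove B) u v)

include hX hconn

theorem ker_partialMonomialMap (hB : ∀ f ∈ B, partialMonomialMap 𝕜 P a f = 0) :
    RingHom.ker (partialMonomialMap 𝕜 P a) = Ideal.span B := by
  refine le_antisymm (fun f hf => ?_) (Ideal.span_le.2 hB)
  let g : {u : σ →₀ ℕ // ∀ x ∈ u.support, P x} → MvPolynomial σ 𝕜 ⧸ Ideal.span B :=
    fun u => Ideal.Quotient.mk _ (monomial u 1)
  have hg : g.FactorsThrough fun u => Finsupp.linearCombination ℕ a u.1 := fun u v h =>
    Ideal.Quotient.eq.2 (monomial_sub_mem_span_of_eqvGen (hconn u v u.2 v.2 h))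
  let ψ : MvPolynomial τ 𝕜 →ₗ[𝕜] MvPolynomial σ 𝕜 ⧸ Ideal.span B :=
    (basisMonomials τ 𝕜).constr 𝕜
      (Function.extend (fun u => Finsupp.linearCombination ℕ a u.1) g 0)
  have hψ : ψ ∘ₗ (partialMonomialMap 𝕜 P a).toLinearMap =
      (Ideal.Quotient.mkₐ 𝕜 (Ideal.span B)).toLinearMap := by
    refine (basisMonomials σ 𝕜).ext fun u => ?_
    simp only [coe_basisMonomials, LinearMap.comp_apply, AlgHom.toLinearMap_apply,
      Ideal.Quotient.mkₐ_eq_mk]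
    by_cases hu : ∀ x ∈ u.support, P x
    · rw [partialMonomialMap_monomial hu]
      refine ((basisMonomials τ 𝕜).constr_basis 𝕜 _ _).trans ?_
      exact hg.extend_apply 0 ⟨u, hu⟩
    · push Not at hu
      obtain ⟨x, hx, hP⟩ := hu
      rw [partialMonomialMap_monomial_eq_zero hx hP, map_zero, eq_comm,
        Ideal.Quotient.eq_zero_iff_mem]
      exact monomial_mem_span_of_X_mem (hX x hP) hx
  have hf' := LinearMap.congr_fun hψ f
  rwa [LinearMap.comp_apply, AlgHom.toLinearMap_apply, AlgHom.toLinearMap_apply,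
    Ideal.Quotient.mkₐ_eq_mk, RingHom.mem_ker.1 hf, map_zero, eq_comm,
    Ideal.Quotient.eq_zero_iff_mem] at hf'

theorem isMarkovBasis_ker_partialMonomialMap [Nontrivial 𝕜]
    (hB : ∀ f ∈ B, partialMonomialMap 𝕜 P a f = 0 ∧
      ((∃ u, f = monomial u 1) ∨ ∃ u v, f = monomial u 1 - monomial v 1)) :
    IsMarkovBasis B (RingHom.ker (partialMonomialMap 𝕜 P a)) := by
  refine ⟨hB, fun u hu => ?_, fun u v hu hv huv => ?_⟩
  · have hP : ¬ ∀ x ∈ u.support, P x := fun hP => by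
      rw [RingHom.mem_ker, partialMonomialMap_monomial hP, monomial_eq_zero] at hu
      exact one_ne_zero hu
    push Not at hP
    obtain ⟨x, hx, hP⟩ := hP
    refine ⟨Finsupp.single x 1, Finsupp.single_le_iff.2 ?_, hX x hP⟩
    exact Nat.one_le_iff_ne_zero.2 (Finsupp.mem_support_iff.1 hx)
  · have hP : ∀ u : σ →₀ ℕ, monomial u (1 : 𝕜) ∉ RingHom.ker (partialMonomialMap 𝕜 P a) →
        ∀ x ∈ u.support, P x := fun u hu x hx => by
      by_contra hP
      exact hu (RingHom.mem_ker.2 (partialMonomialMap_monomial_eq_zero hx hP))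
    rw [RingHom.mem_ker, map_sub, partialMonomialMap_monomial (hP u hu),
      partialMonomialMap_monomial (hP v hv), sub_eq_zero] at huv
    exact hconn u v (hP u hu) (hP v hv) (monomial_left_injective one_ne_zero huv)

end MarkovMoves

section Boxes

variable {V : Type*}

/-- The box of an indeterminate: the multiset of its indices. -/
def varBox : MomentVar V → Multiset V :=
  Sum.elim (fun z => Sym2.equivSym V z) fun t => t

theorem varBox_sVar (i j : V) : varBox (sVar i j) = i ::ₘ {j} := rfl

theorem varBox_tVar (i j k : V) : varBox (tVar i j k) = i ::ₘ {j, k} := rfl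

theorem card_varBox (x : MomentVar V) : (varBox x).card = 2 ∨ (varBox x).card = 3 :=
  x.rec (fun _ => Or.inl Sym.card_coe) fun _ => Or.inr Sym.card_coe

theorem varBox_injective : Function.Injective (varBox : MomentVar V → Multiset V) :=
  (Sym.coe_injective.comp (Sym2.equivSym V).injective).sumElim Sym.coe_injective fun z t h => by
    simpa using congrArg Multiset.card h

theorem eq_sVar_or_eq_tVar (x : MomentVar V) :
    (∃ i j, x = sVar i j) ∨ ∃ i j k, x = tVar i j k := by
  rcases card_varBox x with h | h
  · obtain ⟨i, j, h⟩ := Multiset.card_eq_two.1 h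
    exact Or.inl ⟨i, j, varBox_injective h⟩
  · obtain ⟨i, j, k, h⟩ := Multiset.card_eq_three.1 h
    exact Or.inr ⟨i, j, k, varBox_injective h⟩

/-- The boxes of the indeterminates of a monomial, which is given by its exponent. -/
noncomputable def boxes : (MomentVar V →₀ ℕ) →+ Multiset (Multiset V) :=
  (Multiset.mapAddMonoidHom varBox).comp Finsupp.toMultiset

theorem boxes_single (x : MomentVar V) : boxes (Finsupp.single x 1) = {varBox x} := by
  simp [boxes]

theorem boxes_injective : Function.Injective (boxes : (MomentVar V →₀ ℕ) → _) := by
  classical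
  exact (Multiset.map_injective varBox_injective).comp Finsupp.orderIsoMultiset.injective

theorem exists_of_boxes_eq_cons {u : MomentVar V →₀ ℕ} {M : Multiset V}
    {U : Multiset (Multiset V)} (h : boxes u = M ::ₘ U) :
    ∃ x u', varBox x = M ∧ boxes u' = U ∧ u = Finsupp.single x 1 + u' := by
  classical
  obtain ⟨x, hx, rfl, hU⟩ := (Multiset.map_eq_cons _ _ _ _).2 h
  have hle : Finsupp.single x 1 ≤ u := by
    rw [Finsupp.mem_toMultiset, Finsupp.mem_support_iff] at hx
    exact Finsupp.single_le_iff.2 (Nat.one_le_iff_ne_zero.2 hx)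
  refine ⟨x, u - Finsupp.single x 1, rfl, ?_, (add_tsub_cancel_of_le hle).symm⟩
  rw [← add_tsub_cancel_of_le hle, map_add, boxes_single, Multiset.singleton_add] at h
  exact (Multiset.cons_inj_right _).1 h

variable [PartialOrder V]

theorem isAdmissible_boxes_iff {u : MomentVar V →₀ ℕ} :
    IsAdmissible (boxes u) ↔ ∀ x ∈ u.support, ∃ v, IsMeet (varBox x) v := by
  have hcard (x : MomentVar V) : 2 ≤ (varBox x).card := by
    rcases card_varBox x with h | h <;> omega
  constructor
  · intro h x hx
    exact (h _ (Multiset.mem_map_of_mem varBox ((Finsupp.mem_toMultiset u x).2 hx))).2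
  · intro h M hM
    obtain ⟨x, hx, rfl⟩ := Multiset.mem_map.1 hM
    exact ⟨hcard x, h x ((Finsupp.mem_toMultiset u x).1 hx)⟩

theorem weight_boxes [Fintype V] [Nonempty V] (u : MomentVar V →₀ ℕ) :
    weight (boxes u) = Finsupp.linearCombination ℕ (fun x => boxWeight (varBox x)) u := by
  induction u using Finsupp.induction_linear with
  | zero => simp [weight]
  | add u v hu hv => simp only [map_add, ← hu, ← hv, weight, Multiset.map_add, Multiset.sum_add]
  | single x n => simp [weight, boxes, Multiset.map_nsmul, Multiset.sum_nsmul]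

end Boxes

section TrekMatrices

variable {V : Type*}

theorem det_trekMatrix (𝕜 : Type*) [CommRing 𝕜] {G : Digraph V} {i j : V}
    (c d : TrekColumn G i j) :
    ((trekMatrix 𝕜 G i j).submatrix id ![c, d]).det =
      monomial (Finsupp.single (trekEntry i c) 1 + Finsupp.single (trekEntry j d) 1) 1 -
        monomial (Finsupp.single (trekEntry j c) 1 + Finsupp.single (trekEntry i d) 1) 1 := by
  have hmul (x y : MomentVar V) :
      monomial (Finsupp.single x 1 + Finsupp.single y 1) (1 : 𝕜) = X x * X y := by
    rw [X, X, monomial_mul, one_mul]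
  rw [Matrix.det_fin_two, hmul, hmul]
  simp only [trekMatrix, Matrix.submatrix_apply, Matrix.of_apply, id, Matrix.cons_val_zero,
    Matrix.cons_val_one]
  ring

theorem isQuadraticBinomial_of_mem_trekMinors {𝕜 : Type*} [CommRing 𝕜] {G : Digraph V}
    {f : MvPolynomial (MomentVar V) 𝕜} (hf : f ∈ trekMinors 𝕜 G) : IsQuadraticBinomial f := by
  obtain ⟨i, j, -, c, d, rfl⟩ := hf
  exact ⟨_, _, by simp, by simp, det_trekMatrix 𝕜 c d⟩

theorem isHomogeneous_of_mem_linearGenerators {𝕜 : Type*} [CommRing 𝕜] {G : Digraph V}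
    {f : MvPolynomial (MomentVar V) 𝕜} (hf : f ∈ linearGenerators 𝕜 G) : f.IsHomogeneous 1 := by
  rcases hf with ⟨i, j, -, rfl⟩ | ⟨i, j, k, -, rfl⟩
  · exact isHomogeneous_X 𝕜 _
  · exact isHomogeneous_X 𝕜 _

variable [PartialOrder V] [Finite V] [IsTrekOrder V]

theorem linearGenerators_coverDigraph (𝕜 : Type*) [CommRing 𝕜] :
    linearGenerators 𝕜 (coverDigraph V) = X '' {x | ¬ ∃ v, IsMeet (varBox x) v} := by
  have hpair (i j : V) : HasTrek (coverDigraph V) ![i, j] ↔ ∃ v, IsMeet (varBox (sVar i j)) v :=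
    hasTrek_iff_exists_isMeet
  have htriple (i j k : V) :
      HasTrek (coverDigraph V) ![i, j, k] ↔ ∃ v, IsMeet (varBox (tVar i j k)) v :=
    hasTrek_iff_exists_isMeet
  ext f
  constructor
  · rintro (⟨i, j, h, rfl⟩ | ⟨i, j, k, h, rfl⟩)
    · exact ⟨_, (hpair i j).not.1 h, rfl⟩
    · exact ⟨_, (htriple i j k).not.1 h, rfl⟩
  · rintro ⟨x, hx, rfl⟩
    rcases eq_sVar_or_eq_tVar x with ⟨i, j, rfl⟩ | ⟨i, j, k, rfl⟩
    · exact Or.inl ⟨i, j, (hpair i j).not.2 hx, rfl⟩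
    · exact Or.inr ⟨i, j, k, (htriple i j k).not.2 hx, rfl⟩

theorem X_mem_generators (𝕜 : Type*) [CommRing 𝕜] {x : MomentVar V}
    (hx : ¬ ∃ v, IsMeet (varBox x) v) :
    X x ∈ linearGenerators 𝕜 (coverDigraph V) ∪ trekMinors 𝕜 (coverDigraph V) :=
  Or.inl (linearGenerators_coverDigraph (V := V) 𝕜 ▸ ⟨x, hx, rfl⟩)

theorem exists_isMeet_of_trekColumn {i j : V} (c : TrekColumn (coverDigraph V) i j) :
    ∃ C s, (∀ r, varBox (trekEntry r c) = r ::ₘ C) ∧ IsMeet (i ::ₘ C) s ∧ IsMeet (j ::ₘ C) s := by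
  rcases c with ⟨k, s, hi, hj⟩ | ⟨⟨l, m⟩, s, hi, hj⟩
  · exact ⟨{k}, s, fun _ => rfl, isMeet_pair_iff_isTop.2 hi, isMeet_pair_iff_isTop.2 hj⟩
  · exact ⟨{l, m}, s, fun _ => rfl, isMeet_triple_iff_isTop.2 hi, isMeet_triple_iff_isTop.2 hj⟩

theorem exists_trekColumn {x : MomentVar V} {r i j s : V} {C : Multiset V}
    (hx : varBox x = r ::ₘ C) (hi : IsMeet (i ::ₘ C) s) (hj : IsMeet (j ::ₘ C) s) :
    ∃ c : TrekColumn (coverDigraph V) i j, ∀ r, varBox (trekEntry r c) = r ::ₘ C := by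
  have hcard : C.card = 1 ∨ C.card = 2 := by
    have := card_varBox x
    rw [hx, Multiset.card_cons] at this
    omega
  rcases hcard with hC | hC
  · obtain ⟨k, rfl⟩ := Multiset.card_eq_one.1 hC
    exact ⟨Sum.inl ⟨k, s, isMeet_pair_iff_isTop.1 hi, isMeet_pair_iff_isTop.1 hj⟩, fun _ => rfl⟩
  · obtain ⟨l, m, rfl⟩ := Multiset.card_eq_two.1 hC
    exact ⟨Sum.inr ⟨(l, m), s, isMeet_triple_iff_isTop.1 hi, isMeet_triple_iff_isTop.1 hj⟩,
      fun _ => rfl⟩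

theorem exists_exchange_of_mem_trekMinors {𝕜 : Type*} [CommRing 𝕜]
    {f : MvPolynomial (MomentVar V) 𝕜} (hf : f ∈ trekMinors 𝕜 (coverDigraph V)) :
    ∃ u v : MomentVar V →₀ ℕ, Exchange (boxes u) (boxes v) ∧
      f = monomial u 1 - monomial v 1 := by
  obtain ⟨i, j, -, c, d, rfl⟩ := hf
  obtain ⟨C, s, hC, hiC, hjC⟩ := exists_isMeet_of_trekColumn c
  obtain ⟨D, t, hD, hiD, hjD⟩ := exists_isMeet_of_trekColumn d
  have hboxes (x y : MomentVar V) :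
      boxes (Finsupp.single x 1 + Finsupp.single y 1) = varBox x ::ₘ varBox y ::ₘ 0 := by
    rw [map_add, boxes_single, boxes_single]
    rfl
  refine ⟨_, _, ⟨i, j, C, D, 0, s, t, ?_, ?_, hiC, hjC, hjD, hiD⟩, det_trekMatrix 𝕜 c d⟩
  · rw [hboxes, hC, hD]
  · rw [hboxes, hC, hD]

theorem Exchange.exists_markovMove (𝕜 : Type*) [CommRing 𝕜] {u : MomentVar V →₀ ℕ}
    {U : Multiset (Multiset V)} (h : Exchange (boxes u) U) :
    ∃ v, boxes v = U ∧ MarkovMove (trekMinors 𝕜 (coverDigraph V)) u v := by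
  obtain ⟨i, j, C, D, R, s, t, hu, rfl, hiC, hjC, hjD, hiD⟩ := h
  obtain ⟨x, u₁, hx, hu₁, rfl⟩ := exists_of_boxes_eq_cons hu
  obtain ⟨y, u₂, hy, rfl, rfl⟩ := exists_of_boxes_eq_cons hu₁
  obtain ⟨c, hc⟩ := exists_trekColumn hx hiC hjC
  obtain ⟨d, hd⟩ := exists_trekColumn hy hiD hjD
  obtain rfl : x = trekEntry i c := varBox_injective (hx.trans (hc i).symm)
  obtain rfl : y = trekEntry j d := varBox_injective (hy.trans (hd j).symm)
  have htrek : HasTrek (coverDigraph V) ![i, j] := hasTrek_coverDigraph_iff.2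
    ⟨s, Fin.forall_fin_two.2 ⟨hiC.1 (Multiset.mem_cons_self i C),
      hjC.1 (Multiset.mem_cons_self j C)⟩⟩
  refine ⟨u₂ + (Finsupp.single (trekEntry j c) 1 + Finsupp.single (trekEntry i d) 1), ?_,
    _, _, u₂, ⟨i, j, htrek, c, d, (det_trekMatrix 𝕜 c d).symm⟩, by abel, rfl⟩
  rw [map_add, map_add, boxes_single, boxes_single, hc, hd, add_comm, add_assoc,
    Multiset.singleton_add, Multiset.singleton_add]

theorem Exchanges.eqvGen_markovMove (𝕜 : Type*) [CommRing 𝕜] {u v : MomentVar V →₀ ℕ}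
    (h : Exchanges (boxes u) (boxes v)) :
    Relation.EqvGen (MarkovMove (trekMinors 𝕜 (coverDigraph V))) u v := by
  suffices ∀ U, Exchanges (boxes u) U → ∃ w : MomentVar V →₀ ℕ, boxes w = U ∧
      Relation.EqvGen (MarkovMove (trekMinors 𝕜 (coverDigraph V))) u w by
    obtain ⟨w, hw, huw⟩ := this _ h
    exact boxes_injective hw ▸ huw
  intro U hU
  induction hU with
  | refl => exact ⟨u, rfl, .refl u⟩
  | tail _ h ih =>
    obtain ⟨w, rfl, hw⟩ := ih
    obtain ⟨w', hw', hmove⟩ := h.exists_markovMove 𝕜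
    exact ⟨w', hw', hw.trans _ _ _ (.rel _ _ hmove)⟩

end TrekMatrices

section TrekMap

variable {V : Type*} [PartialOrder V] [Fintype V] [Nonempty V]

/-- The simple trek rule, as a map of polynomial rings: an indeterminate is sent to the monomial of
the simple trek between its indices, or to zero if there is no trek. -/
noncomputable def trekMap (V 𝕜 : Type*) [PartialOrder V] [Fintype V] [Nonempty V] [CommRing 𝕜] :
    MvPolynomial (MomentVar V) 𝕜 →ₐ[𝕜] MvPolynomial (TrekParam V) 𝕜 :=
  partialMonomialMap 𝕜 (fun x => ∃ v, IsMeet (varBox x) v) fun x => boxWeight (varBox x)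

variable [IsTrekOrder V] {𝕜 : Type*} [CommRing 𝕜]

theorem Exchange.trekMap_monomial_eq {u v : MomentVar V →₀ ℕ} (h : Exchange (boxes u) (boxes v)) :
    trekMap V 𝕜 (monomial u 1) = trekMap V 𝕜 (monomial v 1) := by
  have hiff : IsAdmissible (boxes u) ↔ IsAdmissible (boxes v) :=
    ⟨h.isAdmissible, h.symm.isAdmissible⟩
  rw [isAdmissible_boxes_iff, isAdmissible_boxes_iff] at hiff
  by_cases hu : ∀ x ∈ u.support, ∃ w, IsMeet (varBox x) w
  · rw [trekMap, partialMonomialMap_monomial hu, partialMonomialMap_monomial (hiff.1 hu),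
      ← weight_boxes, ← weight_boxes, h.weight_eq]
  · have hv := hiff.not.1 hu
    push Not at hu hv
    obtain ⟨x, hx, hx'⟩ := hu
    obtain ⟨y, hy, hy'⟩ := hv
    rw [trekMap, partialMonomialMap_monomial_eq_zero hx (by simpa using hx'),
      partialMonomialMap_monomial_eq_zero hy (by simpa using hy')]

theorem trekMap_eq_zero_of_mem_generators {f : MvPolynomial (MomentVar V) 𝕜}
    (hf : f ∈ linearGenerators 𝕜 (coverDigraph V) ∪ trekMinors 𝕜 (coverDigraph V)) :
    trekMap V 𝕜 f = 0 := by
  rcases hf with hf | hf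
  · rw [linearGenerators_coverDigraph] at hf
    obtain ⟨x, hx, rfl⟩ := hf
    exact partialMonomialMap_monomial_eq_zero (x := x) (by simp) hx
  · obtain ⟨u, v, h, rfl⟩ := exists_exchange_of_mem_trekMinors hf
    rw [map_sub, h.trekMap_monomial_eq, sub_self]

theorem eqvGen_markovMove_of_linearCombination_eq (𝕜 : Type*) [CommRing 𝕜]
    {u v : MomentVar V →₀ ℕ} (hu : ∀ x ∈ u.support, ∃ w, IsMeet (varBox x) w)
    (hv : ∀ x ∈ v.support, ∃ w, IsMeet (varBox x) w)
    (h : Finsupp.linearCombination ℕ (fun x => boxWeight (varBox x)) u =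
      Finsupp.linearCombination ℕ (fun x => boxWeight (varBox x)) v) :
    Relation.EqvGen (MarkovMove
      (linearGenerators 𝕜 (coverDigraph V) ∪ trekMinors 𝕜 (coverDigraph V))) u v := by
  rw [← weight_boxes, ← weight_boxes] at h
  exact (exchanges_of_weight_eq (isAdmissible_boxes_iff.2 hu) (isAdmissible_boxes_iff.2 hv)
    h).eqvGen_markovMove 𝕜 |>.mono fun _ _ => MarkovMove.mono Set.subset_union_right

theorem ker_trekMap : RingHom.ker (trekMap V 𝕜) = trekIdeal 𝕜 (coverDigraph V) :=
  ker_partialMonomialMap (fun _ => X_mem_generators 𝕜)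
    (fun _ _ => eqvGen_markovMove_of_linearCombination_eq 𝕜)
    fun _ => trekMap_eq_zero_of_mem_generators

end TrekMap

theorem isMarkovBasis_generators {V : Type*} [PartialOrder V] [Finite V] [Nonempty V]
    [IsTrekOrder V] {𝕜 : Type*} [CommRing 𝕜] [Nontrivial 𝕜] :
    IsMarkovBasis (linearGenerators 𝕜 (coverDigraph V) ∪ trekMinors 𝕜 (coverDigraph V))
      (trekIdeal 𝕜 (coverDigraph V)) := by
  have := Fintype.ofFinite V
  rw [← ker_trekMap]
  refine isMarkovBasis_ker_partialMonomialMap (fun _ => X_mem_generators 𝕜)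
    (fun _ _ => eqvGen_markovMove_of_linearCombination_eq 𝕜)
    fun f hf => ⟨trekMap_eq_zero_of_mem_generators hf, ?_⟩
  rcases hf with hf | hf
  · rw [linearGenerators_coverDigraph] at hf
    obtain ⟨x, -, rfl⟩ := hf
    exact Or.inl ⟨_, rfl⟩
  · obtain ⟨u, v, -, -, rfl⟩ := isQuadraticBinomial_of_mem_trekMinors hf
    exact Or.inr ⟨u, v, rfl⟩

section PathMatrix

variable {V : Type*} [PartialOrder V] [Fintype V] {R : Type*} [CommRing R]

open Classical in
/-- The product of the edge weights along the directed path from `s` to `i`, or zero if there is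
no such path. -/
noncomputable def pathMatrix (Λ : Matrix V V R) : Matrix V V R :=
  Matrix.of fun s i => if s ≤ i then ∏ e ∈ pathEdges s i, Λ e.1 e.2 else 0

theorem pathMatrix_of_le (Λ : Matrix V V R) {s i : V} (h : s ≤ i) :
    pathMatrix Λ s i = ∏ e ∈ pathEdges s i, Λ e.1 e.2 :=
  if_pos h

theorem pathMatrix_of_not_le (Λ : Matrix V V R) {s i : V} (h : ¬ s ≤ i) : pathMatrix Λ s i = 0 :=
  if_neg h

theorem pathMatrix_self (Λ : Matrix V V R) (s : V) : pathMatrix Λ s s = 1 := by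
  rw [pathMatrix_of_le Λ le_rfl, pathEdges_self, Finset.prod_empty]

theorem pathMatrix_of_covBy (Λ : Matrix V V R) {s i : V} (h : s ⋖ i) :
    pathMatrix Λ s i = Λ s i := by
  rw [pathMatrix_of_le Λ h.le, pathEdges_of_covBy h, Finset.prod_singleton]

theorem pathMatrix_map_pow (Λ : Matrix V V R) {m : ℕ} (hm : m ≠ 0) (s i : V) :
    pathMatrix (Λ.map (· ^ m)) s i = pathMatrix Λ s i ^ m := by
  by_cases h : s ≤ i
  · simp only [pathMatrix_of_le _ h, Matrix.map_apply, Finset.prod_pow]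
  · rw [pathMatrix_of_not_le _ h, pathMatrix_of_not_le _ h, zero_pow hm]

theorem sum_pathMatrix_mul_of_not_lt {Λ : Matrix V V R} (hΛ : ∀ i j, ¬ i ⋖ j → Λ i j = 0)
    {s i : V} (h : ¬ s < i) : ∑ x, pathMatrix Λ s x * Λ x i = 0 := by
  refine Finset.sum_eq_zero fun x _ => ?_
  by_cases hxi : x ⋖ i
  · rw [pathMatrix_of_not_le Λ fun hsx => h (hsx.trans_lt hxi.lt), zero_mul]
  · rw [hΛ _ _ hxi, mul_zero]

variable [IsTrekOrder V]

theorem pathMatrix_mul (Λ : Matrix V V R) {s g i : V} (hs : s ≤ g) (hi : g ≤ i) :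
    pathMatrix Λ s i = pathMatrix Λ s g * pathMatrix Λ g i := by
  classical
  rw [pathMatrix_of_le _ hs, pathMatrix_of_le _ hi, pathMatrix_of_le _ (hs.trans hi),
    pathEdges_eq_union hs hi, Finset.prod_union (disjoint_pathEdges s g i)]

theorem sum_pathMatrix_mul_of_lt {Λ : Matrix V V R} (hΛ : ∀ i j, ¬ i ⋖ j → Λ i j = 0) {s i : V}
    (h : s < i) : ∑ x, pathMatrix Λ s x * Λ x i = pathMatrix Λ s i := by
  obtain ⟨u, hsu, hui⟩ := exists_le_covBy_of_lt h
  rw [pathMatrix_mul Λ hsu hui.le, pathMatrix_of_covBy Λ hui]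
  refine Finset.sum_eq_single_of_mem u (Finset.mem_univ u) fun x _ hx => ?_
  by_cases hxi : x ⋖ i
  · rw [pathMatrix_of_not_le, zero_mul]
    intro hsx
    rcases le_total_of_mem_Icc hsx hsu hxi.le hui.le with hxu | hux
    · exact hxi.2 (lt_of_le_of_ne hxu hx) hui.lt
    · exact hui.2 (lt_of_le_of_ne hux hx.symm) hxi.lt
  · rw [hΛ _ _ hxi, mul_zero]

theorem pathMatrix_mul_one_sub [DecidableEq V] {Λ : Matrix V V R}
    (hΛ : ∀ i j, ¬ i ⋖ j → Λ i j = 0) : pathMatrix Λ * (1 - Λ) = 1 := by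
  ext s i
  rw [mul_sub, mul_one, Matrix.sub_apply, Matrix.mul_apply]
  rcases eq_or_ne s i with rfl | hne
  · rw [sum_pathMatrix_mul_of_not_lt hΛ (lt_irrefl s), pathMatrix_self, sub_zero,
      Matrix.one_apply_eq]
  rw [Matrix.one_apply_ne hne]
  by_cases h : s < i
  · rw [sum_pathMatrix_mul_of_lt hΛ h, sub_self]
  · rw [sum_pathMatrix_mul_of_not_lt hΛ h,
      pathMatrix_of_not_le Λ fun hle => h (lt_of_le_of_ne hle hne), sub_zero]

theorem inv_one_sub_eq_pathMatrix [DecidableEq V] {Λ : Matrix V V R}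
    (hΛ : ∀ i j, ¬ i ⋖ j → Λ i j = 0) : (1 - Λ)⁻¹ = pathMatrix Λ :=
  Matrix.inv_eq_left_inv (pathMatrix_mul_one_sub hΛ)

/-- The entrywise power `Λ.map (· ^ m)` is again a matrix of edge weights, and the entries of the
inverse of `1 - Λ.map (· ^ m)` are the powers of those of `pathMatrix Λ`. -/
theorem sum_sub_mul_pathMatrix_pow {Λ : Matrix V V R} (hΛ : ∀ i j, ¬ i ⋖ j → Λ i j = 0)
    {m : ℕ} (hm : m ≠ 0) (a : V → R) (v : V) :
    ∑ u, (a u - ∑ p, a p * Λ p u ^ m) * pathMatrix Λ u v ^ m = a v := by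
  classical
  have hinv : (1 - Λ.map (· ^ m)) * pathMatrix (Λ.map (· ^ m)) = 1 :=
    mul_eq_one_comm.1 <| pathMatrix_mul_one_sub fun i j h => by
      rw [Matrix.map_apply, hΛ i j h, zero_pow hm]
  have hvec := congrFun (congrArg (Matrix.vecMul a) hinv) v
  rw [← Matrix.vecMul_vecMul, Matrix.vecMul_sub, Matrix.vecMul_one] at hvec
  simpa only [Matrix.vecMul, dotProduct, Pi.sub_apply, Matrix.map_apply,
    pathMatrix_map_pow Λ hm] using hvec

end PathMatrix

section DiagMoment

variable {V : Type*} [Fintype V] {R : Type*} [CommRing R]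

/-- The joint moment of the linear combinations `∑ u, L u i * ε u`, for `i` in the multiset `M`,
when the moments of order `M.card` of the noise `ε` form a diagonal tensor with diagonal `ω`. -/
def diagMoment (L : Matrix V V R) (ω : V → R) (M : Multiset V) : R :=
  ∑ u, ω u * (M.map (L u)).prod

theorem transpose_mul_diagonal_mul_apply [DecidableEq V] (L : Matrix V V R) (ω : V → R) (i j : V) :
    (L.transpose * Matrix.diagonal ω * L) i j = diagMoment L ω (varBox (sVar i j)) := by
  rw [Matrix.mul_apply, diagMoment]
  refine Finset.sum_congr rfl fun u _ => ?_
  rw [Matrix.mul_diagonal, Matrix.transpose_apply, varBox_sVar, Multiset.map_cons,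
    Multiset.map_singleton, Multiset.prod_cons, Multiset.prod_singleton]
  ring

theorem tucker_apply_of_isDiagTensor (L : Matrix V V ℝ) {Ω : V → V → V → ℝ}
    (hΩ : IsDiagTensor Ω) (i j k : V) :
    tucker Ω L L L i j k = diagMoment L (fun u => Ω u u u) (varBox (tVar i j k)) := by
  refine Finset.sum_congr rfl fun u _ => ?_
  rw [Finset.sum_eq_single_of_mem u (Finset.mem_univ u) fun b _ hb => ?_,
    Finset.sum_eq_single_of_mem u (Finset.mem_univ u) fun c _ hc => ?_, varBox_tVar]
  · simp only [Multiset.insert_eq_cons, Multiset.map_cons, Multiset.map_singleton,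
      Multiset.prod_cons, Multiset.prod_singleton]
    ring
  · rw [hΩ u u c fun h => hc h.2.symm]
    ring
  · refine Finset.sum_eq_zero fun c _ => ?_
    rw [hΩ u b c fun h => hb h.1.symm]
    ring

variable [PartialOrder V]

theorem diagMoment_pathMatrix_eq_zero [IsTrekOrder V] (Λ : Matrix V V R) (ω : V → R)
    {M : Multiset V} (hM : M ≠ 0) (h : ¬ ∃ v, IsMeet M v) :
    diagMoment (pathMatrix Λ) ω M = 0 := by
  refine Finset.sum_eq_zero fun u _ => ?_
  obtain ⟨i, hi, hui⟩ : ∃ i ∈ M, ¬ u ≤ i := by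
    by_contra! hu
    exact h (exists_isMeet hM hu)
  rw [Multiset.prod_eq_zero (Multiset.mem_map.2 ⟨i, hi, pathMatrix_of_not_le Λ hui⟩), mul_zero]

/-- The simple trek rule: all paths to the elements of `M` from one vertex pass through `v`. -/
theorem IsMeet.diagMoment_pathMatrix [IsTrekOrder V] (Λ : Matrix V V R) (ω : V → R)
    {M : Multiset V} {v : V} (hM : M ≠ 0) (hv : IsMeet M v) :
    diagMoment (pathMatrix Λ) ω M =
      (∑ u, ω u * pathMatrix Λ u v ^ M.card) * (M.map (pathMatrix Λ v)).prod := by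
  rw [diagMoment, Finset.sum_mul]
  refine Finset.sum_congr rfl fun u _ => ?_
  by_cases huv : u ≤ v
  · rw [Multiset.map_congr rfl fun i hi => pathMatrix_mul Λ huv (hv.1 hi), Multiset.prod_map_mul,
      Multiset.map_const', Multiset.prod_replicate, mul_assoc]
  · obtain ⟨i, hi, hui⟩ : ∃ i ∈ M, ¬ u ≤ i := by
      by_contra! h
      exact huv (hv.2 h)
    rw [pathMatrix_of_not_le Λ huv, zero_pow (Multiset.card_eq_zero.not.2 hM), mul_zero, zero_mul,
      Multiset.prod_eq_zero (Multiset.mem_map.2 ⟨i, hi, pathMatrix_of_not_le Λ hui⟩), mul_zero]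

end DiagMoment

section Parametrization

variable {V : Type*} [PartialOrder V] [Fintype V] {R : Type*} [CommRing R]

theorem eval_monomial_pathWeight (θ : TrekParam V → R) (s i : V) :
    eval θ (monomial (pathWeight s i) 1) = ∏ e ∈ pathEdges s i, θ (Sum.inr e) := by
  rw [pathWeight, monomial_sum_one, map_prod]
  exact Finset.prod_congr rfl fun e _ => eval_X (Sum.inr e)

theorem eval_monomial_sum_pathWeight (θ : TrekParam V → R) (s : V) (M : Multiset V) :
    eval θ (monomial (M.map (pathWeight s)).sum 1) =
      (M.map fun i => ∏ e ∈ pathEdges s i, θ (Sum.inr e)).prod := by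
  induction M using Multiset.induction_on with
  | empty => simp
  | cons i M ih =>
    rw [Multiset.map_cons, Multiset.sum_cons, Multiset.map_cons, Multiset.prod_cons, ← ih,
      ← eval_monomial_pathWeight, ← map_mul, monomial_mul, one_mul]

variable [Nonempty V]

/-- The value of the indeterminate `x` at the parameters `θ`, by the simple trek rule. -/
noncomputable def trekValue (θ : TrekParam V → R) (x : MomentVar V) : R :=
  eval θ (trekMap V R (X x))

theorem eval_trekMap (θ : TrekParam V → R) (f : MvPolynomial (MomentVar V) R) :
    eval θ (trekMap V R f) = eval (trekValue θ) f := by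
  have h : (aeval θ).comp (trekMap V R) = aeval (trekValue θ) :=
    algHom_ext fun x => (aeval_X (trekValue θ) x).symm
  exact DFunLike.congr_fun h f

theorem trekValue_eq_zero (θ : TrekParam V → R) {x : MomentVar V}
    (hx : ¬ ∃ v, IsMeet (varBox x) v) : trekValue θ x = 0 := by
  rw [trekValue, trekMap, X, partialMonomialMap_monomial_eq_zero (x := x) (by simp) hx, map_zero]

theorem IsMeet.trekValue_eq (θ : TrekParam V → R) {x : MomentVar V} {v : V}
    (hv : IsMeet (varBox x) v) :
    trekValue θ x = θ (Sum.inl ((varBox x).card, v)) *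
      ((varBox x).map fun i => ∏ e ∈ pathEdges v i, θ (Sum.inr e)).prod := by
  have hsupport : ∀ y ∈ (Finsupp.single x 1).support, ∃ v, IsMeet (varBox y) v := fun y hy => by
    obtain rfl := Finset.mem_singleton.1 (Finsupp.support_single_subset hy)
    exact ⟨v, hv⟩
  rw [trekValue, trekMap, X, partialMonomialMap_monomial hsupport, Finsupp.linearCombination_single,
    one_smul, hv.boxWeight_eq, ← eval_monomial_sum_pathWeight, ← eval_X (f := θ) (Sum.inl _), X,
    ← map_mul, monomial_mul, one_mul]

theorem trekValue_congr {θ θ' : TrekParam V → R}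
    (hinl : ∀ m ≠ 0, ∀ v, θ (Sum.inl (m, v)) = θ' (Sum.inl (m, v)))
    (hinr : ∀ u c, u ⋖ c → θ (Sum.inr (u, c)) = θ' (Sum.inr (u, c))) :
    trekValue θ = trekValue θ' := by
  funext x
  by_cases hx : ∃ v, IsMeet (varBox x) v
  · obtain ⟨v, hv⟩ := hx
    have hcard : (varBox x).card ≠ 0 := by
      rcases card_varBox x with h | h <;> omega
    simp only [hv.trekValue_eq, hinl _ hcard]
    congr 3
    funext i
    exact Finset.prod_congr rfl fun e he => hinr _ _ (mem_pathEdges.1 he).1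
  · rw [trekValue_eq_zero θ hx, trekValue_eq_zero θ' hx]

theorem trekValue_ringHom_comp {S : Type*} [CommRing S] (φ : R →+* S) (θ : TrekParam V → R)
    (x : MomentVar V) : trekValue (fun q => φ (θ q)) x = φ (trekValue θ x) := by
  by_cases hx : ∃ v, IsMeet (varBox x) v
  · obtain ⟨v, hv⟩ := hx
    simp only [hv.trekValue_eq, map_mul, map_multiset_prod, Multiset.map_map, Function.comp_def,
      map_prod]
  · rw [trekValue_eq_zero _ hx, trekValue_eq_zero _ hx, map_zero]

/-- The parameters of the simple trek rule in the model with edge coefficients `Λ` whose noise at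
the vertex `u` has the `m`-th moment `ω m u`. -/
noncomputable def modelParam (Λ : Matrix V V R) (ω : ℕ → V → R) : TrekParam V → R :=
  Sum.elim (fun q => ∑ u, ω q.1 u * pathMatrix Λ u q.2 ^ q.1) fun e => Λ e.1 e.2

variable [IsTrekOrder V]

theorem diagMoment_pathMatrix_eq_trekValue (Λ : Matrix V V R) (ω : ℕ → V → R) (x : MomentVar V) :
    diagMoment (pathMatrix Λ) (ω (varBox x).card) (varBox x) =
      trekValue (modelParam Λ ω) x := by
  have hne : varBox x ≠ 0 := fun h => by
    have := card_varBox x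
    simp [h] at this
  by_cases hx : ∃ v, IsMeet (varBox x) v
  · obtain ⟨v, hv⟩ := hx
    rw [hv.diagMoment_pathMatrix Λ _ hne, hv.trekValue_eq]
    exact congrArg _ (congrArg _ (Multiset.map_congr rfl fun i hi => pathMatrix_of_le Λ (hv.1 hi)))
  · rw [diagMoment_pathMatrix_eq_zero Λ _ hne hx, trekValue_eq_zero _ hx]

theorem trekValue_modelParam_eq {θ : TrekParam V → R} {Λ : Matrix V V R}
    (hΛ : ∀ i j, ¬ i ⋖ j → Λ i j = 0) (hθ : ∀ u c, u ⋖ c → Λ u c = θ (Sum.inr (u, c))) :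
    trekValue (modelParam Λ fun m u =>
      θ (Sum.inl (m, u)) - ∑ p, θ (Sum.inl (m, p)) * Λ p u ^ m) = trekValue θ :=
  trekValue_congr (fun m hm => sum_sub_mul_pathMatrix_pow hΛ hm fun u => θ (Sum.inl (m, u))) hθ

end Parametrization

section Model

theorem sub_sum_mul_sq_pos {V : Type*} [Fintype V] {a : V → ℝ} {Λ : Matrix V V ℝ}
    (ha : ∀ u, a u ∈ Set.Ioo 1 2)
    (hΛ : ∀ p u, Λ p u ∈ Set.Ico 0 (1 / (2 * ((Fintype.card V : ℝ) + 1)))) (u : V) :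
    0 < a u - ∑ p, a p * Λ p u ^ 2 := by
  set n : ℝ := (Fintype.card V : ℝ)
  have hn : 0 ≤ n := Nat.cast_nonneg _
  have hterm (p : V) : a p * Λ p u ^ 2 ≤ 1 / (n + 1) := by
    have hε : 1 / (2 * (n + 1)) ≤ 1 := by
      rw [div_le_one (by positivity)]
      linarith
    have hsq : Λ p u ^ 2 ≤ 1 / (2 * (n + 1)) :=
      (pow_le_of_le_one (hΛ p u).1 ((hΛ p u).2.le.trans hε) two_ne_zero).trans (hΛ p u).2.le
    calc a p * Λ p u ^ 2 ≤ 2 * (1 / (2 * (n + 1))) :=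
          mul_le_mul (ha p).2.le hsq (sq_nonneg _) zero_le_two
      _ = 1 / (n + 1) := by field_simp
  have hsum : ∑ p, a p * Λ p u ^ 2 < 1 := calc
    ∑ p, a p * Λ p u ^ 2 ≤ n * (1 / (n + 1)) := by
      simpa [n] using Finset.sum_le_sum fun p (_ : p ∈ Finset.univ) => hterm p
    _ < 1 := by
      rw [mul_one_div, div_lt_one (by positivity)]
      linarith
  linarith [(ha u).1]

theorem mem_modelPoints_iff {V : Type*} [Fintype V] [DecidableEq V] {𝕜 : Type*} [RCLike 𝕜]
    {G : Digraph V} {p : MomentVar V → 𝕜} :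
    p ∈ modelPoints 𝕜 G ↔ ∃ (Λ : Matrix V V ℝ) (ω : ℕ → V → ℝ),
      IsEdgeWeight G Λ ∧ (∀ u, 0 < ω 2 u) ∧
        ∀ x, p x = (diagMoment (1 - Λ)⁻¹ (ω (varBox x).card) (varBox x) : ℝ) := by
  constructor
  · rintro ⟨⟨S, T⟩, ⟨Λ, Ω₂, Ω₃, hΛ, hpos, hΩ₂, hΩ₃, hS, hT⟩, hpS, hpT⟩
    obtain ⟨d, rfl⟩ : ∃ d, Ω₂ = Matrix.diagonal d := ⟨_, hΩ₂.diagonal_diag.symm⟩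
    refine ⟨Λ, fun m u => if m = 2 then d u else Ω₃ u u u, hΛ,
      fun u => Matrix.posDef_diagonal_iff.1 hpos u, fun x => ?_⟩
    rcases eq_sVar_or_eq_tVar x with ⟨i, j, rfl⟩ | ⟨i, j, k, rfl⟩
    · exact (hpS i j).trans (congrArg _ ((congrFun₂ hS i j).trans
        (transpose_mul_diagonal_mul_apply _ d i j)))
    · exact (hpT i j k).trans (congrArg _ ((congrFun (congrFun₂ hT i j) k).trans
        (tucker_apply_of_isDiagTensor _ hΩ₃ i j k)))
  · rintro ⟨Λ, ω, hΛ, hpos, hp⟩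
    let Ω₃ : V → V → V → ℝ := fun i j k => if i = j ∧ j = k then ω 3 i else 0
    have hΩ₃ : IsDiagTensor Ω₃ := fun i j k h => if_neg h
    have hdiag : (fun u => Ω₃ u u u) = ω 3 := funext fun u => if_pos ⟨rfl, rfl⟩
    refine ⟨(_, _), ⟨Λ, Matrix.diagonal (ω 2), Ω₃, hΛ, Matrix.PosDef.diagonal hpos,
      Matrix.isDiag_diagonal _, hΩ₃, rfl, rfl⟩, fun i j => ?_, fun i j k => ?_⟩
    · exact (hp _).trans (congrArg _ (transpose_mul_diagonal_mul_apply _ (ω 2) i j).symm)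
    · refine (hp _).trans (congrArg _ (Eq.symm ?_))
      exact (tucker_apply_of_isDiagTensor _ hΩ₃ i j k).trans (by rw [hdiag]; rfl)

variable {V : Type*} [PartialOrder V] [Fintype V] [Nonempty V] [IsTrekOrder V] [DecidableEq V]
  {𝕜 : Type*} [RCLike 𝕜]

theorem mem_modelPoints_coverDigraph_iff {p : MomentVar V → 𝕜} :
    p ∈ modelPoints 𝕜 (coverDigraph V) ↔ ∃ (Λ : Matrix V V ℝ) (ω : ℕ → V → ℝ),
      (∀ i j, ¬ i ⋖ j → Λ i j = 0) ∧ (∀ u, 0 < ω 2 u) ∧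
        ∀ x, p x = (trekValue (modelParam Λ ω) x : ℝ) := by
  rw [mem_modelPoints_iff]
  refine exists₂_congr fun Λ ω => and_congr_right fun hΛ => ?_
  simp only [← diagMoment_pathMatrix_eq_trekValue, inv_one_sub_eq_pathMatrix hΛ]

theorem trekValue_mem_modelPoints {t : TrekParam V → ℝ}
    (ha : ∀ q, t (Sum.inl q) ∈ Set.Ioo 1 2)
    (hl : ∀ e, t (Sum.inr e) ∈ Set.Ioo 0 (1 / (2 * ((Fintype.card V : ℝ) + 1)))) :
    trekValue (fun q => (t q : 𝕜)) ∈ modelPoints 𝕜 (coverDigraph V) := by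
  classical
  let Λ : Matrix V V ℝ := fun u c => if u ⋖ c then t (Sum.inr (u, c)) else 0
  have hΛ (u c : V) (h : ¬ u ⋖ c) : Λ u c = 0 := if_neg h
  have hΛt (u c : V) (h : u ⋖ c) : Λ u c = t (Sum.inr (u, c)) := if_pos h
  let ω (m : ℕ) (u : V) : ℝ := t (Sum.inl (m, u)) - ∑ p, t (Sum.inl (m, p)) * Λ p u ^ m
  have hω : ∀ u, 0 < ω 2 u := sub_sum_mul_sq_pos (fun u => ha (2, u)) fun u c => ?_
  · refine mem_modelPoints_coverDigraph_iff.2 ⟨Λ, ω, hΛ, hω, fun x => ?_⟩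
    exact (trekValue_ringHom_comp (algebraMap ℝ 𝕜) t x).trans
      (congrArg _ (congrFun (trekValue_modelParam_eq hΛ hΛt) x).symm)
  · by_cases h : u ⋖ c
    · exact hΛt u c h ▸ Set.Ioo_subset_Ico_self (hl (u, c))
    · rw [hΛ u c h]
      exact Set.left_mem_Ico.2 (by positivity)

theorem momentIdeal_eq_ker_trekMap :
    momentIdeal 𝕜 (coverDigraph V) = RingHom.ker (trekMap V 𝕜) := by
  ext f
  rw [momentIdeal, mem_vanishingIdeal_iff, RingHom.mem_ker]
  constructor
  · intro hf
    let s : TrekParam V → Set ℝ := Sum.elim (fun _ => Set.Ioo 1 2)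
      fun _ => Set.Ioo 0 (1 / (2 * (Fintype.card V + 1)))
    have hs (q : TrekParam V) : (s q).Infinite := by
      rcases q with _ | _
      · exact Set.Ioo_infinite one_lt_two
      · exact Set.Ioo_infinite (by positivity)
    refine funext_set (fun q => (fun r : ℝ => (r : 𝕜)) '' s q)
      (fun q => (hs q).image RCLike.ofReal_injective.injOn) fun θ hθ => ?_
    choose t ht htθ using fun q => hθ q trivial
    obtain rfl : (fun q => (t q : 𝕜)) = θ := funext htθ
    rw [map_zero, eval_trekMap]
    exact hf _ (trekValue_mem_modelPoints (fun q => ht (Sum.inl q)) fun e => ht (Sum.inr e))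
  · intro hf p hp
    obtain ⟨Λ, ω, -, -, hp⟩ := mem_modelPoints_coverDigraph_iff.1 hp
    have hpθ : p = trekValue fun q => ((modelParam Λ ω q : ℝ) : 𝕜) := by
      funext x
      rw [hp x]
      exact (trekValue_ringHom_comp (algebraMap ℝ 𝕜) (modelParam Λ ω) x).symm
    rw [hpθ]
    refine (eval_trekMap _ f).symm.trans ?_
    rw [hf, map_zero]

end Model

section Polytree

variable {V : Type*} {G : Digraph V}

/-- The reachability order of an acyclic directed graph. -/
abbrev reachOrder (G : Digraph V) (h : IsAcyclic G) : PartialOrder V where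
  le := Relation.ReflTransGen G.Adj
  le_refl _ := .refl
  le_trans _ _ _ := .trans
  le_antisymm a b hab hba := by
    rcases Relation.reflTransGen_iff_eq_or_transGen.1 hab with hba' | hab
    · exact hba'.symm
    · exact absurd (hab.trans_left hba) (h a)

/-- The edge from `v` to `c` leads into `K`, and every other edge stays inside `K` or outside. -/
structure IsCut (G : Digraph V) (v c : V) (K : Set V) : Prop where
  notMem : v ∉ K
  mem : c ∈ K
  mem_iff_mem : ∀ {a b}, G.Adj a b → (a, b) ≠ (v, c) → (a ∈ K ↔ b ∈ K)

theorem IsCut.mem_of_reflTransGen {v c x y : V} {K : Set V} (hK : IsCut G v c K)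
    (h : Relation.ReflTransGen G.Adj x y) (hx : x ∈ K) : y ∈ K := by
  induction h with
  | refl => exact hx
  | @tail a b _ hab ih =>
    by_cases he : (a, b) = (v, c)
    · obtain ⟨-, rfl⟩ := Prod.mk_inj.1 he
      exact hK.mem
    · exact (hK.mem_iff_mem hab he).1 ih

theorem IsCut.reflTransGen_of_notMem_of_mem {v c x y : V} {K : Set V} (hK : IsCut G v c K)
    (h : Relation.ReflTransGen G.Adj x y) (hx : x ∉ K) (hy : y ∈ K) :
    Relation.ReflTransGen G.Adj x v := by
  induction h with
  | refl => exact absurd hy hx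
  | @tail a b hxa hab ih =>
    by_cases he : (a, b) = (v, c)
    · obtain ⟨rfl, -⟩ := Prod.mk_inj.1 he
      exact hxa
    · exact ih ((hK.mem_iff_mem hab he).2 hy)

theorem IsPolytree.exists_isCut (hG : IsPolytree G) {v c : V} (hvc : G.Adj v c) :
    ∃ K, IsCut G v c K := by
  have hne {a b : V} (hab : G.Adj a b) : a ≠ b := by
    rintro rfl
    exact hG.1 a (.single hab)
  let H := G.toSimpleGraphInclusive
  have hadj {a b : V} (hab : G.Adj a b) : H.Adj a b := ⟨hne hab, Or.inl hab⟩
  refine ⟨{x | (H.deleteEdges {s(v, c)}).Reachable x c}, ?_, .refl _, fun {a b} hab hdiff => ?_⟩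
  · exact SimpleGraph.isBridge_iff.1
      (SimpleGraph.isAcyclic_iff_forall_adj_isBridge.1 hG.2.isAcyclic (hadj hvc))
  · have hedge : s(a, b) ≠ s(v, c) := by
      rw [Ne, Sym2.eq_iff]
      rintro (⟨rfl, rfl⟩ | ⟨rfl, rfl⟩)
      · exact hdiff rfl
      · exact hG.1 a ((Relation.TransGen.single hab).tail hvc)
    have hr : (H.deleteEdges {s(v, c)}).Adj a b :=
      SimpleGraph.deleteEdges_adj.2 ⟨hadj hab, hedge⟩
    exact ⟨hr.symm.reachable.trans, hr.reachable.trans⟩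

theorem IsPolytree.reflTransGen_of_branch (hG : IsPolytree G) {v c c' i j w : V}
    (hc : G.Adj v c) (hc' : G.Adj v c') (hne : c ≠ c') (hci : Relation.ReflTransGen G.Adj c i)
    (hcj : Relation.ReflTransGen G.Adj c' j) (hwi : Relation.ReflTransGen G.Adj w i)
    (hwj : Relation.ReflTransGen G.Adj w j) : Relation.ReflTransGen G.Adj w v := by
  obtain ⟨K, hK⟩ := hG.exists_isCut hc
  have hi : i ∈ K := hK.mem_of_reflTransGen hci hK.mem
  have hc'K : c' ∉ K := fun h => hK.notMem ((hK.mem_iff_mem hc' (by simp [hne.symm])).2 h)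
  have hj : j ∉ K := fun h =>
    hG.1 v (.head' hc' (hK.reflTransGen_of_notMem_of_mem hcj hc'K h))
  have hw : w ∉ K := fun h => hj (hK.mem_of_reflTransGen hwj h)
  exact hK.reflTransGen_of_notMem_of_mem hwi hw hi

theorem IsPolytree.covBy_iff_adj (hG : IsPolytree G) {v c : V} :
    letI := reachOrder G hG.1
    v ⋖ c ↔ G.Adj v c := by
  let := reachOrder G hG.1
  have hlt {a b : V} (h : G.Adj a b) : a < b :=
    lt_of_le_not_ge (.single h) fun hba => hG.1 a (.head' h hba)
  refine ⟨fun h => ?_, fun h => ⟨hlt h, fun x hvx hxc => ?_⟩⟩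
  · rcases h.le.cases_head with h' | ⟨x, hx, hxc⟩
    · exact absurd h' h.ne
    · exact (h.eq_or_eq (hlt hx).le hxc).resolve_left (hlt hx).ne' ▸ hx
  · rcases hvx.le.cases_head with h' | ⟨y, hy, hyx⟩
    · exact hvx.ne h'
    have hne : c ≠ y := by
      rintro rfl
      exact hxc.not_ge hyx
    exact (hlt h).not_ge (hG.reflTransGen_of_branch h hy hne .refl (hyx.trans hxc.le) .refl .refl)

theorem IsPolytree.eq_coverDigraph (hG : IsPolytree G) :
    letI := reachOrder G hG.1
    G = coverDigraph V :=
  Digraph.ext <| funext₂ fun _ _ => propext hG.covBy_iff_adj.symm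

theorem IsPolytree.isTrekOrder (hG : IsPolytree G) : @IsTrekOrder V (reachOrder G hG.1) :=
  letI := reachOrder G hG.1
  ⟨fun hc hc' => hG.reflTransGen_of_branch (hG.covBy_iff_adj.1 hc) (hG.covBy_iff_adj.1 hc')⟩

end Polytree

end ThirdMoment

theorem mainTheorem1_general {V : Type*} [Fintype V] [DecidableEq V] [Nonempty V] [PartialOrder V]
    [ThirdMoment.IsTrekOrder V] (𝕜 : Type*) [RCLike 𝕜] :
    letI G := ThirdMoment.coverDigraph V
    ThirdMoment.momentIdeal 𝕜 G = ThirdMoment.trekIdeal 𝕜 G ∧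
    (∀ f ∈ ThirdMoment.linearGenerators 𝕜 G, f.IsHomogeneous 1) ∧
    (∀ f ∈ ThirdMoment.trekMinors 𝕜 G, ThirdMoment.IsQuadraticBinomial f) ∧
    ThirdMoment.IsMarkovBasis
      (ThirdMoment.linearGenerators 𝕜 G ∪ ThirdMoment.trekMinors 𝕜 G)
      (ThirdMoment.momentIdeal 𝕜 G) := by
  have hideal := (ThirdMoment.momentIdeal_eq_ker_trekMap (V := V) (𝕜 := 𝕜)).trans
    ThirdMoment.ker_trekMap
  exact ⟨hideal, fun _ => ThirdMoment.isHomogeneous_of_mem_linearGenerators,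
    fun _ => ThirdMoment.isQuadraticBinomial_of_mem_trekMinors,
    hideal ▸ ThirdMoment.isMarkovBasis_generators⟩

theorem mainTheorem1 {V : Type*} [Fintype V] [DecidableEq V] (𝕜 : Type*) [RCLike 𝕜]
    (G : Digraph V) (hG : ThirdMoment.IsPolytree G) :
    ThirdMoment.momentIdeal 𝕜 G = ThirdMoment.trekIdeal 𝕜 G ∧
    (∀ f ∈ ThirdMoment.linearGenerators 𝕜 G, f.IsHomogeneous 1) ∧
    (∀ f ∈ ThirdMoment.trekMinors 𝕜 G, ThirdMoment.IsQuadraticBinomial f) ∧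
    ThirdMoment.IsMarkovBasis
      (ThirdMoment.linearGenerators 𝕜 G ∪ ThirdMoment.trekMinors 𝕜 G)
      (ThirdMoment.momentIdeal 𝕜 G) := by
  let := ThirdMoment.reachOrder G hG.1
  have := hG.isTrekOrder
  have : Nonempty V := hG.2.connected.nonempty
  exact hG.eq_coverDigraph ▸ mainTheorem1_general 𝕜
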